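/- For a set $\Gamma\subseteq\mathbb{R}$ let $\mathcal{M}(\Gamma)$ be the set of finite Borel measures on $\mathbb{R}$ of constant sign (positive or negative), with all moments finite and with infinite support contained in $\Gamma$. Let $\Gamma_1,\Gamma_2\subseteq\mathbb{R}$ be closed intervals (bounded or not) whose interiors are disjoint, let $\sigma_1\in\mathcal{M}(\Gamma_1)$, $\sigma_2\in\mathcal{M}(\Gamma_2)$, and put $m_{\sigma_2}(x)=\int\frac{d\sigma_2(t)}{t-x}$. Assume that $m_{\sigma_2}(x)\,d\sigma_1(x)$ is a finite measure, i.e. $\iint\frac{d|\sigma_2|(t)\,d|\sigma_1|(x)}{|t-x|}<\infty$, where $\frac{1}{|t-x|}=\infty$ for $t=x$ (this is automatic if $\Gamma_1\cap\Gamma_2=\varnothing$). Let $(\mu_1,\mu_2)=\mathcal{N}(\sigma_1,\sigma_2)$ be the Nikishin system generated by $(\sigma_1,\sigma_2)$, that is, $\mu_1=\sigma_1$ and $d\mu_2(x)=m_{\sigma_2}(x)\,d\sigma_1(x)$, with $\mu_1,\mu_2\in\mathcal{M}(\mathbb{R})$. For $\mathbf{n}=(n_1,n_2)\in\mathbb{N}^2$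 (where $0\in\mathbb{N}$) and $|\mathbf{n}|=n_1+n_2$, a type I multiple orthogonal polynomial at $\mathbf{n}$ is a nonzero vector $\mathbf{A}_{\mathbf{n}}=(A^{(1)}_{\mathbf{n}},A^{(2)}_{\mathbf{n}})$ of polynomials with complex coefficients such that $\deg A^{(j)}_{\mathbf{n}}\le n_j-1$ (so $A^{(j)}_{\mathbf{n}}=0$ if $n_j=0$) and $$\sum_{j=1}^{2}\int A^{(j)}_{\mathbf{n}}(x)\,x^k\,d\mu_j(x)=\begin{cases}0,&k=0,1,\dots,|\mathbf{n}|-2,\\ 1,&k=|\mathbf{n}|-1.\end{cases}$$ Then the following hold. (i) If $n_1+1\le n_2$ and $n_1\ne0$, then there is exactly one type I multiple orthogonal polynomial $\mathbf{A}_{\mathbf{n}}$ at $\mathbf{n}$; all complex zeros of $A^{(1)}_{\mathbf{n}}$ are real, they lie in the interior of $\Gamma_2$, and each of them is simple. In particular $A^{(1)}_{\mathbf{n}}\neq 0$. (ii) If $n_1+1\ge n_2$ and $n_2\ne0$, then there is exactly one type I multiple orthogonal polynomial $\mathbf{A}_{\mathbf{n}}$ at $\mathbf{n}$; all complex zeros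 of $A^{(2)}_{\mathbf{n}}$ are real, they lie in the interior of $\Gamma_2$, and each of them is simple. In particular $A^{(2)}_{\mathbf{n}}\neq 0$. -/

import Mathlib

open MeasureTheory MeasureTheory.VectorMeasure ContinuousLinearMap Polynomial
open scoped ENNReal

noncomputable section

/-- The class `M(Γ)`: finite Borel measures on the line of constant sign (positive or negative),
with all moments finite and with infinite support contained in `Γ`. A `SignedMeasure` is
automatically finite; its support is that of its total variation measure. -/
structure MemM (Γ : Set ℝ) (μ : SignedMeasure ℝ) : Prop where
  constant_sign : 0 ≤ μ ∨ μ ≤ 0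
  moments : ∀ k : ℕ, μ.Integrable (fun x : ℝ => x ^ k)
  support_infinite : μ.variation.support.Infinite
  support_subset : μ.variation.support ⊆ Γ

/-- The `m`-function `m_σ(x) = ∫ dσ(t) / (t - x)`, at real points `x`. -/
def mFunction (σ : SignedMeasure ℝ) (x : ℝ) : ℝ :=
  ∫ᵛ t, (t - x)⁻¹ ∂<•σ

/-- The requirement that `m_{σ₂}(x) dσ₁(x)` is a finite measure, i.e.
`∫ (∫ d|σ₂|(t) / |t - x|) d|σ₁|(x) < ∞`. The integrand is `[0, ∞]`-valued and equals `∞` at `t = x`.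
For `x` and `t` in closed intervals with disjoint interiors, `t - x` does not change sign, so the
inner integral is `|m_{σ₂}(x)|`. -/
def BracketFinite (σ₁ σ₂ : SignedMeasure ℝ) : Prop :=
  ∫⁻ x, ∫⁻ t, ‖t - x‖ₑ⁻¹ ∂σ₂.variation ∂σ₁.variation < ∞

/-- The measure `⟨σ₁, σ₂⟩`, given by `d⟨σ₁, σ₂⟩(x) = m_{σ₂}(x) dσ₁(x)`
(meaningful under `BracketFinite σ₁ σ₂`). -/
def bracket (σ₁ σ₂ : SignedMeasure ℝ) : SignedMeasure ℝ :=
  σ₁.withDensity (mFunction σ₂) (lsmul ℝ ℝ).flip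

/-- A closed interval of the real line, bounded or unbounded. -/
def IsClosedInterval (Γ : Set ℝ) : Prop :=
  IsClosed Γ ∧ Γ.OrdConnected

/-- `(μ₁, μ₂) = N(σ₁, σ₂)` is a Nikishin system generated by `(σ₁, σ₂)`, with respect to the closed
intervals `Γ₁`, `Γ₂`. The intervals may share an endpoint. -/
structure IsNikishin (Γ₁ Γ₂ : Set ℝ) (σ₁ σ₂ μ₁ μ₂ : SignedMeasure ℝ) : Prop where
  interval₁ : IsClosedInterval Γ₁
  interval₂ : IsClosedInterval Γ₂
  disjoint_interior : interior Γ₁ ∩ interior Γ₂ = ∅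
  memM_σ₁ : MemM Γ₁ σ₁
  memM_σ₂ : MemM Γ₂ σ₂
  finite : BracketFinite σ₁ σ₂
  eq₁ : μ₁ = σ₁
  eq₂ : μ₂ = bracket σ₁ σ₂
  memM_μ₁ : MemM Set.univ μ₁
  memM_μ₂ : MemM Set.univ μ₂

/-- `A = (A⁽¹⁾, …, A⁽ʳ⁾)` is a type I multiple orthogonal polynomial for the system
`μ = (μ₁, …, μ_r)` at the multi-index `n`: a nonzero vector of polynomials with
`deg A⁽ʲ⁾ ≤ n_j - 1` such that `∑ⱼ ∫ A⁽ʲ⁾(x) x^k dμⱼ(x)` is `0` for `0 ≤ k ≤ |n| - 2` and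
is `1` for `k = |n| - 1`. -/
structure IsTypeI {r : ℕ} (μ : Fin r → SignedMeasure ℝ) (n : Fin r → ℕ)
    (A : Fin r → ℂ[X]) : Prop where
  ne_zero : A ≠ 0
  degree_lt : ∀ j, (A j).degree < (n j : WithBot ℕ)
  orthogonal : ∀ k : ℕ, k + 1 < ∑ j, n j →
    ∑ j, ∫ᵛ x : ℝ, (A j).eval (x : ℂ) * (x : ℂ) ^ k ∂<•(μ j) = 0
  normalized : ∀ k : ℕ, k + 1 = ∑ j, n j →
    ∑ j, ∫ᵛ x : ℝ, (A j).eval (x : ℂ) * (x : ℂ) ^ k ∂<•(μ j) = 1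

/-- The set `Z[p]` of complex zeros of `p`. -/
def zeroSet (p : ℂ[X]) : Set ℂ := {z | p.IsRoot z}

/-- A polynomial is real-rooted if all its complex zeros are real. (The zero polynomial is not.) -/
def RealRooted (p : ℂ[X]) : Prop := zeroSet p ⊆ Set.range ((↑) : ℝ → ℂ)

/-- All zeros of `p` are simple. -/
def SimpleZeros (p : ℂ[X]) : Prop := ∀ z ∈ zeroSet p, p.rootMultiplicity z = 1

end

/-! Up to signs, replace the generators by positive measures `ν₁`, `ν₂`, and let m be the Cauchy
transform of `ν₂`. The type I conditions make L = A₁ + A₂ m orthogonal to the powers below |n| - 1,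
so L has a set X of |n| - 1 zeros outside the interior of Γ₂ (`exists_zeros_of_orthogonal`). Write
Q_X for the monic polynomial with zero set X.

For A₂ (`CauchyData.exists_zeros_right`): partial fractions turn ∫ T A₂ / Q_X dν₂ into a sum of T A₂
m / Q_X' = -T A₁ / Q_X' over X, a divided difference that vanishes when deg (T A₁) < |X| - 1. As Q_X
has constant sign on Γ₂, this is an orthogonality relation, and it forces at least |X| - n₁ = n₂ - 1
sign changes of A₂ in the interior of Γ₂.

For A₁ (`CauchyData.exists_zeros_left`) one would divide by m and use an integral representation of
1/m. A finite substitute suffices: `CauchyData.exists_interpolation` agrees with 1/m at prescribed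
nodes by a rational function with simple poles in the interior of Γ₂ and residues of one sign. It is
the reciprocal of a multipoint Padé approximant of m, whose residues have one sign as Gauss
quadrature weights do. Its poles then play the role of the measure.

The same zero counts with one more vanishing moment exceed the degree, so the homogeneous moment
problem has only the zero solution. This yields existence and uniqueness at every nonzero index, and
reality of the coefficients. -/

/-! ### Lagrange interpolation and partial fractions at real nodes -/

/-- The product `∏ (x - y)` over the nodes `y ∈ X` other than `x`. -/
noncomputable def nodeDenom (X : Finset ℝ) (x : ℝ) : ℝ := ∏ y ∈ X.erase x, (x - y)

/-- The monic polynomial with simple zeros at the points of `X`. -/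
noncomputable def nodePoly (X : Finset ℝ) : ℝ[X] := ∏ x ∈ X, (Polynomial.X - C x)

lemma eval_nodePoly (X : Finset ℝ) (t : ℝ) : (nodePoly X).eval t = ∏ x ∈ X, (t - x) := by
  simp [nodePoly, eval_prod]

lemma nodePoly_monic (X : Finset ℝ) : (nodePoly X).Monic :=
  monic_prod_of_monic _ _ fun _ _ => monic_X_sub_C _

lemma natDegree_nodePoly (X : Finset ℝ) : (nodePoly X).natDegree = X.card := by
  rw [nodePoly, natDegree_prod_of_monic _ _ fun x _ => monic_X_sub_C x]
  simp

lemma eval_nodePoly_eq_zero_iff (X : Finset ℝ) (t : ℝ) : (nodePoly X).eval t = 0 ↔ t ∈ X := by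
  rw [eval_nodePoly, Finset.prod_eq_zero_iff]
  constructor
  · rintro ⟨x, hx, h⟩
    rwa [sub_eq_zero.1 h]
  · exact fun h => ⟨t, h, sub_self t⟩

lemma eval_nodePoly_erase_mul {X : Finset ℝ} {x : ℝ} (hx : x ∈ X) (t : ℝ) :
    (nodePoly (X.erase x)).eval t * (t - x) = (nodePoly X).eval t := by
  simp only [eval_nodePoly]
  rw [Finset.prod_erase_mul X (fun y => t - y) hx]

lemma eval_nodePoly_erase_self (X : Finset ℝ) (x : ℝ) :
    (nodePoly (X.erase x)).eval x = nodeDenom X x := by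
  rw [eval_nodePoly, nodeDenom]

lemma nodeDenom_ne_zero (X : Finset ℝ) (x : ℝ) : nodeDenom X x ≠ 0 := by
  rw [nodeDenom, Finset.prod_ne_zero_iff]
  exact fun y hy => sub_ne_zero.2 (Finset.ne_of_mem_erase hy).symm

lemma degree_mul_lt {R : Type*} [Semiring R] {p q : R[X]} {a n : ℕ}
    (hp : p.natDegree ≤ a) (hq : q.degree < (n : WithBot ℕ)) :
    (p * q).degree < ((a + n : ℕ) : WithBot ℕ) := by
  rcases eq_or_ne q 0 with rfl | hq0
  · simp
  · have h1 : q.natDegree < n := (natDegree_lt_iff_degree_lt hq0).2 hq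
    have h2 := natDegree_mul_le (p := p) (q := q)
    refine (degree_le_natDegree).trans_lt ?_
    exact_mod_cast (by omega : (p * q).natDegree < a + n)

/-- The sum is the divided difference of f at S, that is, the coefficient of order |S| - 1 of f.
This discrete orthogonality is the source of every vanishing sum below. -/
lemma sum_eval_div_nodeDenom {S : Finset ℝ} {f : ℝ[X]} {n : ℕ}
    (hf : f.degree < (n : WithBot ℕ)) (hn : n + 1 ≤ S.card) :
    ∑ s ∈ S, f.eval s / nodeDenom S s = 0 := by
  have h := Lagrange.coeff_eq_sum (s := S) (v := id) (Set.injOn_id _) (P := f)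
    (hf.trans_le (by exact_mod_cast (by omega : n ≤ S.card)))
  simp only [id] at h
  simp only [nodeDenom]
  rw [← h]
  exact coeff_eq_zero_of_degree_lt (hf.trans_le (by exact_mod_cast (by omega : n ≤ S.card - 1)))

lemma nodeDenom_union_left {X T : Finset ℝ} (h : Disjoint X T) {x : ℝ} (hx : x ∈ X) :
    nodeDenom (X ∪ T) x = nodeDenom X x * (nodePoly T).eval x := by
  have hxT : x ∉ T := Finset.disjoint_left.1 h hx
  rw [nodeDenom, nodeDenom, eval_nodePoly, Finset.erase_union_distrib, Finset.erase_eq_of_notMem hxT,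
    Finset.prod_union (h.mono_left (Finset.erase_subset _ _))]

/-- The residues of f / (Q_X Q_T) sum to zero, split by which factor vanishes. -/
lemma sum_union_div_nodeDenom {X T : Finset ℝ} (h : Disjoint X T) {f : ℝ[X]} {n : ℕ}
    (hf : f.degree < (n : WithBot ℕ)) (hn : n + 1 ≤ X.card + T.card) :
    ∑ x ∈ X, f.eval x / (nodeDenom X x * (nodePoly T).eval x) +
      ∑ z ∈ T, f.eval z / (nodeDenom T z * (nodePoly X).eval z) = 0 := by
  rw [← Finset.card_union_of_disjoint h] at hn
  rw [← sum_eval_div_nodeDenom hf hn, Finset.sum_union h]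
  congr 1
  · exact Finset.sum_congr rfl fun x hx => by rw [nodeDenom_union_left h hx]
  · exact Finset.sum_congr rfl fun x hx => by
      rw [Finset.union_comm, nodeDenom_union_left h.symm hx]

/-- Partial fractions. -/
lemma eval_div_nodePoly {X : Finset ℝ} {f : ℝ[X]} (hf : f.degree < (X.card : WithBot ℕ))
    {t : ℝ} (ht : t ∉ X) :
    f.eval t / (nodePoly X).eval t = ∑ x ∈ X, f.eval x / nodeDenom X x * (t - x)⁻¹ := by
  have h := sum_union_div_nodeDenom (X := X) (T := {t}) (by simpa using ht) hf (by simp)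
  have h1 : nodeDenom {t} t = 1 := by simp [nodeDenom]
  simp only [Finset.sum_singleton, h1, one_mul] at h
  have : ∀ x ∈ X, f.eval x / (nodeDenom X x * (nodePoly {t}).eval x) =
      - (f.eval x / nodeDenom X x * (t - x)⁻¹) := by
    intro x hx
    rw [eval_nodePoly, Finset.prod_singleton, ← neg_sub t x, ← div_div, div_neg, div_eq_mul_inv]
  rw [Finset.sum_congr rfl this, Finset.sum_neg_distrib] at h
  linarith

lemma eq_zero_of_degree_lt_of_card_le {p : ℝ[X]} {n : ℕ} (hp : p.degree < (n : WithBot ℕ))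
    {X : Finset ℝ} (hX : n ≤ X.card) (h : ∀ x ∈ X, p.eval x = 0) : p = 0 :=
  eq_zero_of_degree_lt_of_eval_finset_eq_zero X (hp.trans_le (by exact_mod_cast hX)) h

lemma card_lt_of_ne_zero {p : ℝ[X]} {n : ℕ} (hp : p.degree < (n : WithBot ℕ)) (h0 : p ≠ 0)
    {X : Finset ℝ} (h : ∀ x ∈ X, p.eval x = 0) : X.card < n := by
  by_contra! hX
  exact h0 (eq_zero_of_degree_lt_of_card_le hp hX h)

lemma exists_eq_C_mul_nodePoly {p : ℝ[X]} (h0 : p ≠ 0) {Y : Finset ℝ}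
    (hp : p.degree < ((Y.card + 1 : ℕ) : WithBot ℕ)) (h : ∀ y ∈ Y, p.eval y = 0) :
    ∃ c : ℝ, c ≠ 0 ∧ p = C c * nodePoly Y := by
  have hd : p.natDegree ≤ Y.card := by
    have := (natDegree_lt_iff_degree_lt h0).2 hp
    omega
  have hdvd : nodePoly Y ∣ p := by
    refine Finset.prod_dvd_of_coprime ?_ fun y hy => dvd_iff_isRoot.2 (h y hy)
    exact fun a _ b _ hab => isCoprime_X_sub_C_of_isUnit_sub (sub_ne_zero.2 hab).isUnit
  obtain ⟨q, rfl⟩ := hdvd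
  have hq0 : q ≠ 0 := right_ne_zero_of_mul h0
  rw [(nodePoly_monic Y).natDegree_mul' hq0, natDegree_nodePoly] at hd
  obtain ⟨c, rfl⟩ := natDegree_eq_zero.1 (by omega : q.natDegree = 0)
  exact ⟨c, by simpa using hq0, mul_comm _ _⟩

/-! ### Sign changes of continuous functions -/

lemma exists_sign_of_ne_zero {J : Set ℝ} (hJ : J.OrdConnected) {L : ℝ → ℝ}
    (hc : ContinuousOn L J) (h : ∀ x ∈ J, L x ≠ 0) :
    ∃ ε : ℝ, (ε = 1 ∨ ε = -1) ∧ ∀ x ∈ J, 0 < ε * L x := by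
  by_cases hpos : ∀ x ∈ J, 0 < L x
  · exact ⟨1, Or.inl rfl, fun x hx => by simpa using hpos x hx⟩
  · push Not at hpos
    obtain ⟨a, ha, hLa⟩ := hpos
    refine ⟨-1, Or.inr rfl, fun x hx => ?_⟩
    by_contra! hx'
    obtain ⟨y, hy, hy0⟩ := hJ.isPreconnected.intermediate_value ha hx hc
      (show (0 : ℝ) ∈ Set.Icc (L a) (L x) from ⟨hLa, by linarith⟩)
    exact h y hy hy0

/-- Induction on the largest candidate zero z: L has a constant sign to the right of z, and the
induction hypothesis handles the left. T collects the candidates at which the recorded signs differ.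
-/
lemma exists_sign_changes (L : ℝ → ℝ) (Z : Finset ℝ) : ∀ {J : Set ℝ}, J.OrdConnected →
    ContinuousOn L J → (∀ x ∈ J, L x = 0 → x ∈ Z) →
    ∃ T ⊆ Z, ∃ ε : ℝ, (ε = 1 ∨ ε = -1) ∧
      ∀ x ∈ J, x ∉ Z → 0 < ε * (L x * (nodePoly T).eval x) := by
  induction Z using Finset.induction_on_max with
  | empty =>
    intro J hJ hc hZ
    obtain ⟨ε, hε, h⟩ := exists_sign_of_ne_zero hJ hc fun x hx h0 => by simpa using hZ x hx h0
    exact ⟨∅, subset_rfl, ε, hε, fun x hx _ => by simpa [nodePoly] using h x hx⟩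
  | insert z Z hz ih =>
    intro J hJ hc hZ
    obtain ⟨T, hT, ε, hε, h⟩ := ih (J := J ∩ Set.Iio z) (hJ.inter Set.ordConnected_Iio)
      (hc.mono Set.inter_subset_left) fun x hx h0 =>
        (Finset.mem_insert.1 (hZ x hx.1 h0)).resolve_left hx.2.ne
    obtain ⟨ε', hε', h'⟩ := exists_sign_of_ne_zero (J := J ∩ Set.Ioi z)
      (hJ.inter Set.ordConnected_Ioi) (hc.mono Set.inter_subset_left) fun x hx h0 => by
        rcases Finset.mem_insert.1 (hZ x hx.1 h0) with rfl | h1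
        · exact lt_irrefl x hx.2
        · exact lt_asymm hx.2 (hz x h1)
    have hTpos : ∀ x, z < x → 0 < (nodePoly T).eval x := fun x hx => by
      rw [eval_nodePoly]
      exact Finset.prod_pos fun y hy => sub_pos.2 ((hz y (hT hy)).trans hx)
    have hzT : z ∉ T := fun hzT => lt_irrefl _ (hz z (hT hzT))
    have hins : ∀ x, (nodePoly (insert z T)).eval x = (x - z) * (nodePoly T).eval x := fun x => by
      rw [eval_nodePoly, eval_nodePoly, Finset.prod_insert hzT]
    -- The polynomial of T is positive to the right of z, so ε and ε' compare the two sides of z. If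
    -- they differ, the extra factor x - z flips the left side only.
    by_cases hεε : ε' = ε
    · refine ⟨T, hT.trans (Finset.subset_insert _ _), ε, hε, fun x hx hxZ => ?_⟩
      rw [Finset.mem_insert, not_or] at hxZ
      rcases lt_or_gt_of_ne hxZ.1 with hlt | hgt
      · exact h x ⟨hx, hlt⟩ hxZ.2
      · have := mul_pos (h' x ⟨hx, hgt⟩) (hTpos x hgt)
        rw [hεε] at this
        linarith
    · have hεε' : ε = -ε' := by
        rcases hε with rfl | rfl <;> rcases hε' with rfl | rfl <;> simp_all
      refine ⟨insert z T, Finset.insert_subset_insert _ hT, ε', hε', fun x hx hxZ => ?_⟩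
      rw [Finset.mem_insert, not_or] at hxZ
      rw [hins]
      rcases lt_or_gt_of_ne hxZ.1 with hlt | hgt
      · have := mul_pos (h x ⟨hx, hlt⟩ hxZ.2) (sub_pos.2 hlt)
        rw [hεε'] at this
        linarith
      · have := mul_pos (mul_pos (h' x ⟨hx, hgt⟩) (hTpos x hgt)) (sub_pos.2 hgt)
        linarith

/-- The real zeros of a nonzero polynomial in an interval, with those where the sign changes. -/
lemma exists_sign_changes_polynomial {p : ℝ[X]} (hp : p ≠ 0) {I : Set ℝ} (hI : I.OrdConnected) :
    ∃ T : Finset ℝ, (∀ z ∈ T, z ∈ I ∧ p.eval z = 0) ∧ ∃ ε : ℝ, (ε = 1 ∨ ε = -1) ∧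
      (∀ x ∈ I, 0 ≤ ε * (p.eval x * (nodePoly T).eval x)) ∧
      ∀ x ∈ I, p.eval x ≠ 0 → 0 < ε * (p.eval x * (nodePoly T).eval x) := by
  classical
  obtain ⟨T, hT, ε, hε, h⟩ := exists_sign_changes (fun x => p.eval x)
    (p.roots.toFinset.filter (· ∈ I)) hI p.continuous.continuousOn
    (fun x hx h0 => by simp [hp, hx, IsRoot.def]; exact h0)
  have key : ∀ x ∈ I, p.eval x ≠ 0 → 0 < ε * (p.eval x * (nodePoly T).eval x) :=
    fun x hx hx0 => h x hx (by simp [hx0])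
  refine ⟨T, fun z hz => ?_, ε, hε, fun x hx => ?_, key⟩
  · have := hT hz
    simp only [Finset.mem_filter, Multiset.mem_toFinset, mem_roots hp, IsRoot.def] at this
    exact ⟨this.2, this.1⟩
  · by_cases hx0 : p.eval x = 0
    · simp [hx0]
    · exact (key x hx hx0).le

/-! ### Cauchy transforms of positive measures and zeros of the second component -/

/-- A measure `ν` on a nondegenerate interval `Γ` that is not carried by a finite set, and a set `J`
of points outside the interior of `Γ` at which the Cauchy transform of `ν` converges absolutely. -/
structure CauchyData (J Γ : Set ℝ) (ν : Measure ℝ) : Prop where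
  ordConnected : Γ.OrdConnected
  interior_nonempty : (interior Γ).Nonempty
  subset_closure : Γ ⊆ closure (interior Γ)
  ae_mem : ∀ᵐ t ∂ν, t ∈ Γ
  not_finite : ∀ F : Finset ℝ, ¬ ∀ᵐ t ∂ν, t ∈ F
  notMem_interior : ∀ x ∈ J, x ∉ interior Γ
  integrable : ∀ x ∈ J, Integrable (fun t => (t - x)⁻¹) ν
  null : ∀ x ∈ J, ν {x} = 0

/-- The Cauchy transform of a positive measure, at real points. -/
noncomputable def cauchyTransform (ν : Measure ℝ) (x : ℝ) : ℝ := ∫ t, (t - x)⁻¹ ∂ν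

lemma Set.OrdConnected.mem_interior_of_lt_of_lt {Γ : Set ℝ} (hΓ : Γ.OrdConnected) {a b x : ℝ}
    (ha : a ∈ Γ) (hb : b ∈ Γ) (hax : a < x) (hxb : x < b) : x ∈ interior Γ :=
  interior_maximal (Set.Ioo_subset_Icc_self.trans (hΓ.out ha hb)) isOpen_Ioo ⟨hax, hxb⟩

namespace CauchyData

variable {J Γ : Set ℝ} {ν : Measure ℝ}

lemma ordConnected_interior (h : CauchyData J Γ ν) : (interior Γ).OrdConnected :=
  ⟨fun a ha b hb x hx => by
    rcases hx.1.eq_or_lt with rfl | h1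
    · exact ha
    rcases hx.2.eq_or_lt with rfl | h2
    · exact hb
    exact h.ordConnected.mem_interior_of_lt_of_lt (interior_subset ha) (interior_subset hb) h1 h2⟩

lemma notMem_of_mem_interior (h : CauchyData J Γ ν) {X : Finset ℝ} (hX : ∀ x ∈ X, x ∈ J) {t : ℝ}
    (ht : t ∈ interior Γ) : t ∉ X := fun htX => h.notMem_interior t (hX t htX) ht

/-- No node is interior to Γ, so each factor t - x keeps its sign on Γ away from X. -/
lemma eval_nodePoly_mul_pos (h : CauchyData J Γ ν) {X : Finset ℝ} (hX : ∀ x ∈ X, x ∈ J)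
    {s t : ℝ} (hs : s ∈ Γ) (hsX : s ∉ X) (ht : t ∈ Γ) (htX : t ∉ X) :
    0 < (nodePoly X).eval s * (nodePoly X).eval t := by
  rw [eval_nodePoly, eval_nodePoly, ← Finset.prod_mul_distrib]
  refine Finset.prod_pos fun x hx => ?_
  have hsx : s ≠ x := fun e => hsX (e ▸ hx)
  have htx : t ≠ x := fun e => htX (e ▸ hx)
  have hxi := h.notMem_interior x (hX x hx)
  rcases lt_or_gt_of_ne hsx with h1 | h1 <;> rcases lt_or_gt_of_ne htx with h2 | h2
  · exact mul_pos_of_neg_of_neg (sub_neg.2 h1) (sub_neg.2 h2)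
  · exact absurd (h.ordConnected.mem_interior_of_lt_of_lt hs ht h1 h2) hxi
  · exact absurd (h.ordConnected.mem_interior_of_lt_of_lt ht hs h2 h1) hxi
  · exact mul_pos (sub_pos.2 h1) (sub_pos.2 h2)

lemma ae_notMem (h : CauchyData J Γ ν) {X : Finset ℝ} (hX : ∀ x ∈ X, x ∈ J) :
    ∀ᵐ t ∂ν, t ∉ X := by
  have : ∀ᵐ t ∂ν, ∀ x ∈ X, t ≠ x := by
    rw [Filter.eventually_all_finset]
    intro x hx
    rw [ae_iff]
    simpa using h.null x (hX x hx)
  filter_upwards [this] with t ht htX using ht t htX rfl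

lemma div_nodePoly_ae_eq (h : CauchyData J Γ ν) {X : Finset ℝ} (hX : ∀ x ∈ X, x ∈ J)
    {f : ℝ[X]} (hf : f.degree < (X.card : WithBot ℕ)) :
    (fun t => f.eval t / (nodePoly X).eval t) =ᵐ[ν]
      fun t => ∑ x ∈ X, f.eval x / nodeDenom X x * (t - x)⁻¹ := by
  filter_upwards [h.ae_notMem hX] with t ht using eval_div_nodePoly hf ht

lemma integrable_div_nodePoly (h : CauchyData J Γ ν) {X : Finset ℝ} (hX : ∀ x ∈ X, x ∈ J)
    {f : ℝ[X]} (hf : f.degree < (X.card : WithBot ℕ)) :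
    Integrable (fun t => f.eval t / (nodePoly X).eval t) ν :=
  (integrable_congr (h.div_nodePoly_ae_eq hX hf)).2
    (integrable_finsetSum _ fun x hx => (h.integrable x (hX x hx)).const_mul _)

lemma integral_div_nodePoly (h : CauchyData J Γ ν) {X : Finset ℝ} (hX : ∀ x ∈ X, x ∈ J)
    {f : ℝ[X]} (hf : f.degree < (X.card : WithBot ℕ)) :
    ∫ t, f.eval t / (nodePoly X).eval t ∂ν =
      ∑ x ∈ X, f.eval x / nodeDenom X x * cauchyTransform ν x := by
  rw [integral_congr_ae (h.div_nodePoly_ae_eq hX hf),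
    integral_finsetSum _ fun x hx => (h.integrable x (hX x hx)).const_mul _]
  simp_rw [integral_const_mul, cauchyTransform]

/-- The point s only records the constant sign of the node polynomial on Γ. Strictness holds because
ν is not carried by the finitely many roots of f. -/
lemma integral_div_nodePoly_pos (h : CauchyData J Γ ν) {X : Finset ℝ} (hX : ∀ x ∈ X, x ∈ J)
    {f : ℝ[X]} (hf : f.degree < (X.card : WithBot ℕ)) (h0 : f ≠ 0)
    (hpos : ∀ t ∈ interior Γ, 0 ≤ f.eval t) {s : ℝ} (hs : s ∈ interior Γ) :
    0 < (∫ t, f.eval t / (nodePoly X).eval t ∂ν) * (nodePoly X).eval s := by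
  classical
  -- The measure may charge endpoints of Γ, so nonnegativity has to pass to the closure.
  have hposΓ : ∀ t ∈ Γ, 0 ≤ f.eval t := fun t ht =>
    closure_minimal (s := interior Γ) (t := {t | 0 ≤ f.eval t}) hpos
      (isClosed_le continuous_const f.continuous) (h.subset_closure ht)
  have hnn : 0 ≤ᵐ[ν] fun t => f.eval t / (nodePoly X).eval t * (nodePoly X).eval s := by
    filter_upwards [h.ae_mem, h.ae_notMem hX] with t ht htX
    have := h.eval_nodePoly_mul_pos hX (interior_subset hs) (h.notMem_of_mem_interior hX hs) ht htX
    have h2 : 0 < (nodePoly X).eval s / (nodePoly X).eval t := div_pos_iff.2 (mul_pos_iff.1 this)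
    have h3 := mul_nonneg (hposΓ t ht) h2.le
    simpa [div_eq_mul_inv, mul_assoc, mul_comm, mul_left_comm] using h3
  rw [← integral_mul_const]
  refine (integral_nonneg_of_ae hnn).lt_of_ne' fun h1 => ?_
  rw [integral_eq_zero_iff_of_nonneg_ae hnn ((h.integrable_div_nodePoly hX hf).mul_const _)] at h1
  refine h.not_finite f.roots.toFinset ?_
  filter_upwards [h1, h.ae_notMem hX] with t ht htX
  have e1 : (nodePoly X).eval t ≠ 0 := fun e => htX ((eval_nodePoly_eq_zero_iff X t).1 e)
  have e2 : (nodePoly X).eval s ≠ 0 := fun e =>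
    h.notMem_of_mem_interior hX hs ((eval_nodePoly_eq_zero_iff X s).1 e)
  simpa [e1, e2, h0, IsRoot.def] using ht

lemma cauchyTransform_mul_pos (h : CauchyData J Γ ν) {x s : ℝ} (hx : x ∈ J)
    (hs : s ∈ interior Γ) : 0 < cauchyTransform ν x * (s - x) := by
  have := h.integral_div_nodePoly_pos (X := {x}) (by simpa using hx) (f := 1)
    (by simp) one_ne_zero (by simp) hs
  simpa [eval_nodePoly, cauchyTransform] using this

lemma cauchyTransform_ne_zero (h : CauchyData J Γ ν) {x : ℝ} (hx : x ∈ J) :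
    cauchyTransform ν x ≠ 0 := by
  obtain ⟨s, hs⟩ := h.interior_nonempty
  exact left_ne_zero_of_mul (h.cauchyTransform_mul_pos hx hs).ne'

/-- If `A₁ + A₂ m` vanishes on `X`, then `A₂` is orthogonal to polynomials of small degree with
respect to a varying measure, so it has many sign changes in the interior of `Γ`. -/
theorem exists_zeros_right (h : CauchyData J Γ ν) {X : Finset ℝ} (hX : ∀ x ∈ X, x ∈ J)
    {A₁ A₂ : ℝ[X]} {n₁ n₂ : ℕ} (h₁ : A₁.degree < (n₁ : WithBot ℕ))
    (h₂ : A₂.degree < (n₂ : WithBot ℕ)) (h0 : A₂ ≠ 0) (hn : n₂ ≤ n₁ + 1)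
    (hL : ∀ x ∈ X, A₁.eval x + A₂.eval x * cauchyTransform ν x = 0) :
    ∃ T : Finset ℝ, (∀ z ∈ T, z ∈ interior Γ ∧ A₂.eval z = 0) ∧ X.card ≤ T.card + n₁ := by
  obtain ⟨T, hT, ε, hε, hpos, -⟩ := exists_sign_changes_polynomial h0 h.ordConnected_interior
  refine ⟨T, hT, ?_⟩
  by_contra! hlt
  obtain ⟨s, hs⟩ := h.interior_nonempty
  have hε0 : ε ≠ 0 := by rcases hε with rfl | rfl <;> norm_num
  have hd : (nodePoly T).natDegree ≤ T.card := (natDegree_nodePoly T).le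
  -- Here n₂ ≤ n₁ + 1 is used: T.card + n₁ < X.card then gives T.card + n₂ ≤ X.card, enough for the
  -- partial fraction expansion.
  have hf : (nodePoly T * (C ε * A₂)).degree < (X.card : WithBot ℕ) :=
    (degree_mul_lt hd (by rwa [degree_C_mul hε0])).trans_le
      (by exact_mod_cast (by omega : T.card + n₂ ≤ X.card))
  have hp := h.integral_div_nodePoly_pos hX hf
    (mul_ne_zero (nodePoly_monic T).ne_zero (mul_ne_zero (by simpa using hε0) h0))
    (fun t ht => by
      have := hpos t ht
      simp only [eval_mul, eval_C]
      linarith) hs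
  rw [h.integral_div_nodePoly hX hf] at hp
  have hz := sum_eval_div_nodeDenom (S := X) (degree_mul_lt hd h₁) (by omega)
  refine hp.ne' ?_
  rw [mul_eq_zero]
  left
  calc _ = ∑ x ∈ X, -ε * ((nodePoly T * A₁).eval x / nodeDenom X x) := by
        refine Finset.sum_congr rfl fun x hx => ?_
        simp only [eval_mul, eval_C]
        have := hL x hx
        linear_combination ε * (nodePoly T).eval x / nodeDenom X x * this
    _ = 0 := by rw [← Finset.mul_sum, hz, mul_zero]

end CauchyData

/-! ### Interpolating the reciprocal of the Cauchy transform, and zeros of the first component -/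

/-- There are n₁ + n₂ free coefficients and fewer homogeneous linear equations. -/
lemma exists_degree_lt_of_card_lt (X : Finset ℝ) (m : ℝ → ℝ) {n₁ n₂ : ℕ}
    (hn : X.card < n₁ + n₂) : ∃ B₁ B₂ : ℝ[X], B₁.degree < (n₁ : WithBot ℕ) ∧
      B₂.degree < (n₂ : WithBot ℕ) ∧ (B₁ ≠ 0 ∨ B₂ ≠ 0) ∧
      ∀ x ∈ X, B₁.eval x + B₂.eval x * m x = 0 := by
  let φ : (degreeLT ℝ n₁ × degreeLT ℝ n₂) →ₗ[ℝ] (X → ℝ) :=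
    { toFun := fun p x => (p.1 : ℝ[X]).eval (x : ℝ) + (p.2 : ℝ[X]).eval (x : ℝ) * m x
      map_add' := fun p q => by
        ext x
        simp
        ring
      map_smul' := fun c p => by
        ext x
        simp
        ring }
  have hd : Module.finrank ℝ (X → ℝ) < Module.finrank ℝ (degreeLT ℝ n₁ × degreeLT ℝ n₂) := by
    rw [Module.finrank_prod, (degreeLTEquiv ℝ n₁).finrank_eq, (degreeLTEquiv ℝ n₂).finrank_eq]
    simpa using hn
  have : Module.Finite ℝ (degreeLT ℝ n₁) := Module.Finite.equiv (degreeLTEquiv ℝ n₁).symm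
  have : Module.Finite ℝ (degreeLT ℝ n₂) := Module.Finite.equiv (degreeLTEquiv ℝ n₂).symm
  obtain ⟨⟨⟨B₁, h₁⟩, ⟨B₂, h₂⟩⟩, hB, hB0⟩ :=
    Submodule.exists_mem_ne_zero_of_ne_bot (LinearMap.ker_ne_bot_of_finrank_lt (f := φ) hd)
  refine ⟨B₁, B₂, mem_degreeLT.1 h₁, mem_degreeLT.1 h₂, ?_, fun x hx => ?_⟩
  · by_contra! hc
    obtain ⟨rfl, rfl⟩ := hc
    exact hB0 rfl
  · exact congrFun (LinearMap.mem_ker.1 hB) ⟨x, hx⟩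

/-- If `B` interlaces `nodePoly Y` in the sense that the residues of `B / nodePoly Y` are positive,
then `B` has `#Y - 1` simple zeros in any interval containing `Y`, and the residues of
`nodePoly Y / B` are negative. -/
lemma exists_eq_C_mul_nodePoly_of_residues_pos {I : Set ℝ} (hI : I.OrdConnected) {Y : Finset ℝ}
    (hY : Y.Nonempty) (hYI : ∀ y ∈ Y, y ∈ I) {B : ℝ[X]} (hB : B.degree < (Y.card : WithBot ℕ))
    (hpos : ∀ y ∈ Y, 0 < B.eval y / nodeDenom Y y) :
    ∃ (T : Finset ℝ) (κ : ℝ), (∀ z ∈ T, z ∈ I) ∧ T.card + 1 = Y.card ∧ κ ≠ 0 ∧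
      B = C κ * nodePoly T ∧ ∀ z ∈ T, κ * nodeDenom T z * (nodePoly Y).eval z < 0 := by
  have hBy : ∀ y ∈ Y, B.eval y ≠ 0 := fun y hy e => by simpa [e] using hpos y hy
  obtain ⟨y₀, hy₀⟩ := hY
  have hB0 : B ≠ 0 := fun e => hBy y₀ hy₀ (by simp [e])
  obtain ⟨T, hT, ε, hε, -, hT'⟩ := exists_sign_changes_polynomial hB0 hI
  have hlt : T.card < Y.card := card_lt_of_ne_zero hB hB0 fun z hz => (hT z hz).2
  have hcard : T.card + 1 = Y.card := by
    -- With fewer than #Y - 1 sign changes, the divided difference of `C ε * nodePoly T` at Y is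
    -- zero, yet each term is positive because it has the sign of the residue of B at y.
    by_contra hne
    have hz := sum_eval_div_nodeDenom (S := Y) (f := C ε * nodePoly T) (n := T.card + 1)
      (by
        rw [degree_C_mul (by rcases hε with rfl | rfl <;> norm_num),
          degree_eq_natDegree (nodePoly_monic T).ne_zero, natDegree_nodePoly]
        exact_mod_cast Nat.lt_succ_self _) (by omega)
    refine (Finset.sum_pos (fun y hy => ?_) ⟨y₀, hy₀⟩).ne' hz
    have h1 := hT' y (hYI y hy) (hBy y hy)
    have h2 := hpos y hy
    have h3 := div_pos (mul_pos h1 h2) (pow_pos (abs_pos.2 (hBy y hy)) 2)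
    rw [sq_abs] at h3
    have hy0 := hBy y hy
    have hD := nodeDenom_ne_zero Y y
    refine h3.trans_eq ?_
    simp only [eval_mul, eval_C]
    field_simp
  obtain ⟨κ, hκ, hBκ⟩ := exists_eq_C_mul_nodePoly hB0 (Y := T) (by rwa [hcard])
    fun z hz => (hT z hz).2
  refine ⟨T, κ, fun z hz => (hT z hz).1, hcard, hκ, hBκ, fun z hz => ?_⟩
  have hzY : z ∉ Y := fun hzY => hBy z hzY (hT z hz).2
  have hQ : (nodePoly Y).eval z ≠ 0 := fun e => hzY ((eval_nodePoly_eq_zero_iff Y z).1 e)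
  -- The left side is the derivative of B / Q_Y at its zero z. By partial fractions it equals minus
  -- a sum of positive residues times (z - y)⁻².
  have hpf := eval_div_nodePoly (X := Y) (f := C κ * nodePoly (T.erase z)) (by
    rw [degree_C_mul hκ, degree_eq_natDegree (nodePoly_monic _).ne_zero, natDegree_nodePoly,
      Finset.card_erase_of_mem hz]
    exact_mod_cast (by omega : T.card - 1 < Y.card)) hzY
  have hneg : ∑ y ∈ Y, (C κ * nodePoly (T.erase z)).eval y / nodeDenom Y y * (z - y)⁻¹ < 0 := by
    refine Finset.sum_neg (fun y hy => ?_) ⟨y₀, hy₀⟩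
    have hzy : z - y ≠ 0 := sub_ne_zero.2 fun e => hzY (e ▸ hy)
    have h1 : (C κ * nodePoly (T.erase z)).eval y * (y - z) = B.eval y := by
      rw [hBκ, eval_mul, eval_mul, mul_assoc, eval_nodePoly_erase_mul hz]
    have h2 : (C κ * nodePoly (T.erase z)).eval y / nodeDenom Y y * (z - y)⁻¹ =
        -(B.eval y / nodeDenom Y y * ((z - y)⁻¹) ^ 2) := by
      rw [← h1]
      have hD := nodeDenom_ne_zero Y y
      field_simp
      ring
    rw [h2, neg_lt_zero]
    exact mul_pos (hpos y hy) (by positivity)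
  rw [← hpf, eval_mul, eval_C, eval_nodePoly_erase_self] at hneg
  have := mul_neg_of_neg_of_pos hneg (sq_pos_of_ne_zero hQ)
  rwa [sq, ← mul_assoc, div_mul_cancel₀ _ hQ] at this

namespace CauchyData

variable {J Γ : Set ℝ} {ν : Measure ℝ}

/-- The reciprocal of the Cauchy transform is interpolated at `2k` points by a rational function
with `k - 1` simple poles in the interior of `Γ` and residues of the same sign. -/
theorem exists_interpolation (h : CauchyData J Γ ν) {X : Finset ℝ} (hX : ∀ x ∈ X, x ∈ J)
    {k : ℕ} (hk : k ≠ 0) (hcard : X.card = 2 * k) :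
    ∃ (T : Finset ℝ) (κ : ℝ) (B : ℝ[X]), (∀ z ∈ T, z ∈ interior Γ) ∧ T.card + 1 = k ∧ κ ≠ 0 ∧
      B.natDegree ≤ k ∧ (∀ z ∈ T, κ * nodeDenom T z * B.eval z < 0) ∧
      ∀ x ∈ X, κ * (nodePoly T).eval x + B.eval x * cauchyTransform ν x = 0 := by
  -- This is 2k + 1 unknowns for 2k equations, with -B₁ / B₂ the multipoint Padé approximant of m.
  -- The denominator B₂ will turn out to have k simple zeros in the interior of Γ.
  obtain ⟨B₁, B₂, h₁, h₂, hne, hB⟩ := exists_degree_lt_of_card_lt X (cauchyTransform ν)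
    (n₁ := k) (n₂ := k + 1) (by omega)
  have hB₂ : B₂ ≠ 0 := by
    rintro rfl
    refine hne.resolve_right (by simp) (eq_zero_of_degree_lt_of_card_le h₁ (X := X) (by omega) ?_)
    exact fun x hx => by simpa using hB x hx
  obtain ⟨Y, hY, hYc⟩ := h.exists_zeros_right hX h₁ h₂ hB₂ le_rfl hB
  have hYlt := card_lt_of_ne_zero h₂ hB₂ fun y hy => (hY y hy).2
  have hYk : Y.card = k := by omega
  obtain ⟨β, hβ, rfl⟩ := exists_eq_C_mul_nodePoly hB₂ (Y := Y) (by rwa [hYk]) fun y hy => (hY y hy).2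
  set B := C β⁻¹ * B₁ with hBdef
  have hBd : B.degree < (k : WithBot ℕ) := by rwa [hBdef, degree_C_mul (inv_ne_zero hβ)]
  have hBx : ∀ x ∈ X, B.eval x + (nodePoly Y).eval x * cauchyTransform ν x = 0 := fun x hx => by
    have := hB x hx
    simp only [hBdef, eval_mul, eval_C] at this ⊢
    field_simp
    linear_combination this
  have hYn : Y.Nonempty := Finset.card_pos.1 (by omega)
  -- As for Gauss weights, integrate the square of `nodePoly (Y.erase y)` against ν divided by Q_X.
  -- On X the interpolation replaces one such factor times m by B(x) / (y - x), and partial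
  -- fractions evaluate the sum at y.
  have hpos : ∀ y ∈ Y, 0 < B.eval y / nodeDenom Y y := by
    intro y hy
    have hyi := (hY y hy).1
    have hyX := h.notMem_of_mem_interior hX hyi
    have hb : (nodePoly (Y.erase y)).natDegree ≤ k - 1 := by
      rw [natDegree_nodePoly, Finset.card_erase_of_mem hy, hYk]
    have hb' : (nodePoly (Y.erase y)).degree < (k : WithBot ℕ) := by
      rw [degree_eq_natDegree (nodePoly_monic _).ne_zero]
      exact_mod_cast (by omega : (nodePoly (Y.erase y)).natDegree < k)
    have hle : ((k - 1 + k : ℕ) : WithBot ℕ) ≤ (X.card : WithBot ℕ) := by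
      exact_mod_cast (by omega : k - 1 + k ≤ X.card)
    have hf := (degree_mul_lt hb hb').trans_le hle
    have hg := (degree_mul_lt hb hBd).trans_le hle
    have hint := h.integral_div_nodePoly_pos hX hf
      (mul_ne_zero (nodePoly_monic _).ne_zero (nodePoly_monic _).ne_zero)
      (fun t _ => by rw [eval_mul]; exact mul_self_nonneg _) hyi
    rw [h.integral_div_nodePoly hX hf] at hint
    have hpf := eval_div_nodePoly hg hyX
    have hQ : (nodePoly X).eval y ≠ 0 := fun e => hyX ((eval_nodePoly_eq_zero_iff X y).1 e)
    have heq : ∑ x ∈ X, (nodePoly (Y.erase y) * nodePoly (Y.erase y)).eval x / nodeDenom X x *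
        cauchyTransform ν x =
        ∑ x ∈ X, (nodePoly (Y.erase y) * B).eval x / nodeDenom X x * (y - x)⁻¹ := by
      refine Finset.sum_congr rfl fun x hx => ?_
      have hxy : y - x ≠ 0 := sub_ne_zero.2 fun e => hyX (e ▸ hx)
      have h1 := hBx x hx
      rw [← eval_nodePoly_erase_mul hy] at h1
      have hD := nodeDenom_ne_zero X x
      simp only [eval_mul]
      field_simp
      linear_combination -(nodePoly (Y.erase y)).eval x * h1
    rw [heq, ← hpf, eval_mul, eval_nodePoly_erase_self, div_mul_cancel₀ _ hQ] at hint
    exact div_pos_iff.2 (mul_pos_iff.1 (by rwa [mul_comm]))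
  obtain ⟨T, κ, hT, hTc, hκ, hBκ, hres⟩ := exists_eq_C_mul_nodePoly_of_residues_pos
    h.ordConnected_interior hYn (fun y hy => (hY y hy).1) (by rwa [hYk]) hpos
  refine ⟨T, κ, nodePoly Y, hT, by omega, hκ, by rw [natDegree_nodePoly, hYk], hres, fun x hx => ?_⟩
  have := hBx x hx
  rwa [hBκ, eval_mul, eval_C] at this

/-- If `A₁ + A₂ m` vanishes on `X`, then so does `A₁ / m + A₂`, and `A₁` has many sign changes in
the interior of `Γ`. -/
theorem exists_zeros_left (h : CauchyData J Γ ν) (hJ : J.Infinite) {X : Finset ℝ}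
    (hX : ∀ x ∈ X, x ∈ J) {A₁ A₂ : ℝ[X]} {n₁ n₂ : ℕ} (h₁ : A₁.degree < (n₁ : WithBot ℕ))
    (h₂ : A₂.degree < (n₂ : WithBot ℕ)) (h0 : A₁ ≠ 0) (hn : n₁ + 1 ≤ n₂)
    (hL : ∀ x ∈ X, A₁.eval x + A₂.eval x * cauchyTransform ν x = 0) :
    ∃ T : Finset ℝ, (∀ z ∈ T, z ∈ interior Γ ∧ A₁.eval z = 0) ∧ X.card ≤ T.card + n₂ := by
  obtain ⟨T, hT, ε, hε, hpos, hpos'⟩ := exists_sign_changes_polynomial h0 h.ordConnected_interior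
  refine ⟨T, hT, ?_⟩
  by_contra! hlt
  -- Padding X to 2 |X| nodes allows k = |X|, so that the interpolant has |X| - 1 poles, more than
  -- A₁ can have zeros under `hlt`.
  obtain ⟨X', hXX', hX'J, hX'c⟩ : ∃ X' : Finset ℝ, X ⊆ X' ∧ (∀ x ∈ X', x ∈ J) ∧
      X'.card = 2 * X.card := by
    obtain ⟨U, hU, hUc⟩ := (hJ.sdiff X.finite_toSet).exists_subset_card_eq X.card
    refine ⟨X ∪ U, Finset.subset_union_left, fun x hx => ?_, ?_⟩
    · rcases Finset.mem_union.1 hx with hx | hx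
      · exact hX x hx
      · exact (hU hx).1
    · rw [Finset.card_union_of_disjoint, hUc, two_mul]
      exact Finset.disjoint_right.2 fun x hx hxX => (hU hx).2 hxX
  obtain ⟨S, κ, B, hS, hSc, hκ, hBd, hres, hB⟩ := h.exists_interpolation hX'J
    (by omega : X.card ≠ 0) hX'c
  have hd : (nodePoly T).natDegree ≤ T.card := (natDegree_nodePoly T).le
  have hdisj : Disjoint X S := Finset.disjoint_right.2 fun z hz =>
    h.notMem_of_mem_interior hX (hS z hz)
  -- The degree bound T.card + |X| + n₁ must stay below |X| + |S| = 2|X| - 1, which follows from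
  -- `hlt` and n₁ + 1 ≤ n₂.
  have hsum := sum_union_div_nodeDenom hdisj (f := (nodePoly T * B) * A₁)
    (degree_mul_lt (natDegree_mul_le.trans (add_le_add hd hBd)) h₁) (by omega)
  -- On X, the relations for L and for the interpolant give B A₁ = κ Q_S A₂, so Q_S cancels and a
  -- divided difference of T A₂ remains.
  have hzero : ∑ x ∈ X, ((nodePoly T * B) * A₁).eval x /
      (nodeDenom X x * (nodePoly S).eval x) = 0 := by
    have hz := sum_eval_div_nodeDenom (S := X) (degree_mul_lt hd h₂) (by omega)
    calc _ = ∑ x ∈ X, κ * ((nodePoly T * A₂).eval x / nodeDenom X x) := by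
          refine Finset.sum_congr rfl fun x hx => ?_
          have h1 := hL x hx
          have h2 := hB x (hXX' hx)
          have hxS : (nodePoly S).eval x ≠ 0 := fun e =>
            Finset.disjoint_left.1 hdisj hx ((eval_nodePoly_eq_zero_iff S x).1 e)
          have hD := nodeDenom_ne_zero X x
          simp only [eval_mul]
          field_simp
          linear_combination (nodePoly T).eval x * (B.eval x * h1 - A₂.eval x * h2)
      _ = 0 := by rw [← Finset.mul_sum, hz, mul_zero]
  rw [hzero, zero_add] at hsum
  obtain ⟨s, hs⟩ := h.interior_nonempty
  -- The constant makes every term over S nonnegative: ε aligns A₁ with Q_T, and the rest aligns the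
  -- residues with the sign of Q_X on Γ.
  set c := -κ * ε * (nodePoly X).eval s
  have hterm : ∀ z ∈ S, 0 < -κ * (nodePoly X).eval s * (B.eval z /
      (nodeDenom S z * (nodePoly X).eval z)) := fun z hz => by
    have h1 := hres z hz
    have h2 := h.eval_nodePoly_mul_pos hX (interior_subset hs) (h.notMem_of_mem_interior hX hs)
      (interior_subset (hS z hz)) (h.notMem_of_mem_interior hX (hS z hz))
    have hD := nodeDenom_ne_zero S z
    have hQ : (nodePoly X).eval z ≠ 0 := right_ne_zero_of_mul h2.ne'
    have h3 := div_pos (mul_pos (neg_pos.2 h1) h2)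
      (mul_pos (sq_pos_of_ne_zero hD) (sq_pos_of_ne_zero hQ))
    refine h3.trans_eq ?_
    field_simp
  have hA : ∀ z ∈ S, A₁.eval z = 0 := by
    intro z hz
    by_contra hz0
    have hall : 0 < ∑ z ∈ S, c * (((nodePoly T * B) * A₁).eval z /
        (nodeDenom S z * (nodePoly X).eval z)) := by
      have hsplit : ∀ z, c * (((nodePoly T * B) * A₁).eval z /
          (nodeDenom S z * (nodePoly X).eval z)) = ε * (A₁.eval z * (nodePoly T).eval z) *
          (-κ * (nodePoly X).eval s * (B.eval z / (nodeDenom S z * (nodePoly X).eval z))) :=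
        fun z => by
          simp only [eval_mul, c]
          ring
      refine Finset.sum_pos' (fun w hw => ?_) ⟨z, hz, ?_⟩
      · rw [hsplit]
        exact mul_nonneg (hpos w (hS w hw)) (hterm w hw).le
      · rw [hsplit]
        exact mul_pos (hpos' z (hS z hz) hz0) (hterm z hz)
    rw [← Finset.mul_sum, hsum, mul_zero] at hall
    exact lt_irrefl _ hall
  -- A₁ vanishes at |X| - 1 points, so |X| ≤ n₁ < n₂, against `hlt`.
  have := card_lt_of_ne_zero h₁ h0 hA
  omega

end CauchyData

/-! ### Continuity of the Cauchy transform on the nodes -/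

-- Supplies the two points whose kernels dominate near x. At an end of J one of them is x itself, so
-- continuity reaches the endpoints.
open Filter Topology in
lemma exists_Icc_mem_nhdsWithin {J : Set ℝ} {x : ℝ} (hx : x ∈ J) :
    ∃ a ∈ J, ∃ b ∈ J, ∀ᶠ y in 𝓝[J] x, y ∈ Set.Icc a b := by
  have h1 : ∃ a ∈ J, ∀ᶠ y in 𝓝[J] x, a ≤ y := by
    by_cases h : ∃ a ∈ J, a < x
    · obtain ⟨a, ha, hax⟩ := h
      exact ⟨a, ha, mem_nhdsWithin_of_mem_nhds (Ici_mem_nhds hax)⟩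
    · push Not at h
      exact ⟨x, hx, by filter_upwards [self_mem_nhdsWithin] with y hy using h y hy⟩
  have h2 : ∃ b ∈ J, ∀ᶠ y in 𝓝[J] x, y ≤ b := by
    by_cases h : ∃ b ∈ J, x < b
    · obtain ⟨b, hb, hxb⟩ := h
      exact ⟨b, hb, mem_nhdsWithin_of_mem_nhds (Iic_mem_nhds hxb)⟩
    · push Not at h
      exact ⟨x, hx, by filter_upwards [self_mem_nhdsWithin] with y hy using h y hy⟩
  obtain ⟨a, ha, ha'⟩ := h1
  obtain ⟨b, hb, hb'⟩ := h2
  exact ⟨a, ha, b, hb, ha'.and hb'⟩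

/-- Seen from t outside (a, b), one of the endpoints is at least as close as y. -/
lemma abs_inv_sub_le {a b t y : ℝ} (hy : y ∈ Set.Icc a b) (ht : t ∉ Set.Ioo a b) (hta : t ≠ a)
    (htb : t ≠ b) : |(t - y)⁻¹| ≤ |(t - a)⁻¹| + |(t - b)⁻¹| := by
  simp only [abs_inv]
  rcases lt_or_gt_of_ne hta with h | h
  · refine le_add_of_le_of_nonneg ?_ (by positivity)
    refine inv_anti₀ (abs_pos.2 (sub_ne_zero.2 hta)) ?_
    rw [abs_of_neg (sub_neg.2 h), abs_of_neg (sub_neg.2 (h.trans_le hy.1))]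
    linarith [hy.1]
  · have hbt : b < t := lt_of_le_of_ne (not_lt.1 fun h' => ht ⟨h, h'⟩) (Ne.symm htb)
    refine le_add_of_nonneg_of_le (by positivity) ?_
    refine inv_anti₀ (abs_pos.2 (sub_ne_zero.2 htb)) ?_
    rw [abs_of_pos (sub_pos.2 hbt), abs_of_pos (sub_pos.2 (hy.2.trans_lt hbt))]
    linarith [hy.2]

lemma CauchyData.continuousOn {J Γ : Set ℝ} {ν : Measure ℝ} (h : CauchyData J Γ ν)
    (hgap : ∀ a ∈ J, ∀ b ∈ J, ∀ t ∈ Γ, t ∉ Set.Ioo a b) : ContinuousOn (cauchyTransform ν) J := by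
  intro x hx
  obtain ⟨a, ha, b, hb, hab⟩ := exists_Icc_mem_nhdsWithin hx
  have hne : ∀ c ∈ J, ∀ᵐ t ∂ν, t ≠ c := fun c hc => by
    rw [ae_iff]
    simpa using h.null c hc
  refine continuousWithinAt_of_dominated (bound := fun t => |(t - a)⁻¹| + |(t - b)⁻¹|)
    ?_ ?_ ((h.integrable a ha).abs.add (h.integrable b hb).abs) ?_
  · filter_upwards [self_mem_nhdsWithin] with y hy using (h.integrable y hy).aestronglyMeasurable
  · filter_upwards [hab] with y hy
    filter_upwards [h.ae_mem, hne a ha, hne b hb] with t ht hta htb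
    exact abs_inv_sub_le hy (hgap a ha b hb t ht) hta htb
  · filter_upwards [hne x hx] with t ht
    exact (continuousAt_const.sub continuousAt_id).continuousWithinAt.inv₀ (sub_ne_zero.2 ht)

/-! ### Zeros forced by orthogonality -/

section Moments

variable {ν : Measure ℝ} {L : ℝ → ℝ}

lemma integrable_mul_eval (hL : ∀ k : ℕ, Integrable (fun x => L x * x ^ k) ν) (p : ℝ[X]) :
    Integrable (fun x => L x * p.eval x) ν := by
  simp_rw [eval_eq_sum_range, Finset.mul_sum]
  refine integrable_finsetSum _ fun i _ => ?_
  simpa [mul_left_comm] using (hL i).const_mul (p.coeff i)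

lemma integral_mul_eval (hL : ∀ k : ℕ, Integrable (fun x => L x * x ^ k) ν) (p : ℝ[X]) :
    ∫ x, L x * p.eval x ∂ν =
      ∑ i ∈ Finset.range (p.natDegree + 1), p.coeff i * ∫ x, L x * x ^ i ∂ν := by
  simp_rw [eval_eq_sum_range, Finset.mul_sum]
  rw [integral_finsetSum _ fun i _ => by
    simpa [mul_left_comm] using (hL i).const_mul (p.coeff i)]
  refine Finset.sum_congr rfl fun i _ => ?_
  rw [← integral_const_mul]
  simp_rw [mul_left_comm]

/-- With fewer than M zeros, the polynomial of the sign changes has degree below M and makes the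
integrand of constant sign, so ν would live on the zero set. Infinitely many zeros are harmless,
since only M are wanted. -/
lemma exists_zeros_of_orthogonal {J : Set ℝ} (hJ : J.OrdConnected) (hc : ContinuousOn L J)
    (hae : ∀ᵐ x ∂ν, x ∈ J) (hfin : ∀ F : Finset ℝ, ¬ ∀ᵐ t ∂ν, t ∈ F)
    (hL : ∀ k : ℕ, Integrable (fun x => L x * x ^ k) ν) {M : ℕ}
    (horth : ∀ k < M, ∫ x, L x * x ^ k ∂ν = 0) :
    ∃ X : Finset ℝ, (∀ x ∈ X, x ∈ J) ∧ (∀ x ∈ X, L x = 0) ∧ X.card = M := by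
  suffices h : ∃ Z : Finset ℝ, (∀ x ∈ Z, x ∈ J ∧ L x = 0) ∧ M ≤ Z.card by
    obtain ⟨Z, hZ, hM⟩ := h
    obtain ⟨X, hX, hXM⟩ := Finset.exists_subset_card_eq hM
    exact ⟨X, fun x hx => (hZ x (hX hx)).1, fun x hx => (hZ x (hX hx)).2, hXM⟩
  rcases ({x | x ∈ J ∧ L x = 0} : Set ℝ).finite_or_infinite with hf | hinf
  · refine ⟨hf.toFinset, fun x hx => by simpa using hx, ?_⟩
    by_contra! hlt
    obtain ⟨T, hT, ε, hε, hpos⟩ := exists_sign_changes L hf.toFinset hJ hc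
      fun x hx h0 => by simp [hx, h0]
    have hTM : (nodePoly T).natDegree < M := by
      rw [natDegree_nodePoly]
      exact (Finset.card_le_card hT).trans_lt hlt
    have hint : ∫ x, ε * (L x * (nodePoly T).eval x) ∂ν = 0 := by
      rw [integral_const_mul, integral_mul_eval hL, Finset.sum_eq_zero, mul_zero]
      intro i hi
      rw [horth i (by rw [Finset.mem_range] at hi; omega), mul_zero]
    have hnn : ∀ x ∈ J, 0 ≤ ε * (L x * (nodePoly T).eval x) := fun x hx => by
      by_cases hxZ : x ∈ hf.toFinset
      · have : L x = 0 := by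
          rw [Set.Finite.mem_toFinset] at hxZ
          exact hxZ.2
        simp [this]
      · exact (hpos x hx hxZ).le
    rw [integral_eq_zero_iff_of_nonneg_ae (by filter_upwards [hae] with x hx using hnn x hx)
      ((integrable_mul_eval hL _).const_mul ε)] at hint
    refine hfin hf.toFinset ?_
    filter_upwards [hint, hae] with x hx hxJ
    by_contra hxZ
    exact (hpos x hxJ hxZ).ne' hx
  · obtain ⟨Z, hZ, hZc⟩ := hinf.exists_subset_card_eq M
    exact ⟨Z, fun x hx => hZ hx, hZc.ge⟩

end Moments

/-! ### Zero counts and unique solvability for positive generators -/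

/-- Positive measures `ν₁` and `ν₂` generating a Nikishin system. -/
structure NikishinData (J Γ : Set ℝ) (ν₁ ν₂ : Measure ℝ) : Prop extends CauchyData J Γ ν₂ where
  ordConnected_nodes : J.OrdConnected
  gap : ∀ a ∈ J, ∀ b ∈ J, ∀ t ∈ Γ, t ∉ Set.Ioo a b
  ae_mem_nodes : ∀ᵐ x ∂ν₁, x ∈ J
  not_finite_nodes : ∀ F : Finset ℝ, ¬ ∀ᵐ x ∂ν₁, x ∈ F
  moments : ∀ k : ℕ, Integrable (fun x => x ^ k) ν₁
  moments_cauchyTransform : ∀ k : ℕ, Integrable (fun x => cauchyTransform ν₂ x * x ^ k) ν₁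

/-- The moments of the linear form `A₁ + A₂ m`. -/
noncomputable def formMoment (ν₁ ν₂ : Measure ℝ) (A₁ A₂ : ℝ[X]) (k : ℕ) : ℝ :=
  ∫ x, (A₁.eval x + A₂.eval x * cauchyTransform ν₂ x) * x ^ k ∂ν₁

namespace NikishinData

variable {J Γ : Set ℝ} {ν₁ ν₂ : Measure ℝ}

lemma infinite_nodes (h : NikishinData J Γ ν₁ ν₂) : J.Infinite := fun hf =>
  h.not_finite_nodes hf.toFinset (by filter_upwards [h.ae_mem_nodes] with x hx using by simpa)

lemma integrable_left (h : NikishinData J Γ ν₁ ν₂) (A : ℝ[X]) (k : ℕ) :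
    Integrable (fun x => A.eval x * x ^ k) ν₁ := by
  have := integrable_mul_eval (ν := ν₁) (L := fun _ => 1) (by simpa using h.moments)
    (A * Polynomial.X ^ k)
  simpa using this

lemma integrable_right (h : NikishinData J Γ ν₁ ν₂) (A : ℝ[X]) (k : ℕ) :
    Integrable (fun x => A.eval x * cauchyTransform ν₂ x * x ^ k) ν₁ := by
  have := integrable_mul_eval h.moments_cauchyTransform (A * Polynomial.X ^ k)
  simpa [mul_assoc, mul_comm, mul_left_comm] using this

lemma integrable_form (h : NikishinData J Γ ν₁ ν₂) (A₁ A₂ : ℝ[X]) (k : ℕ) :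
    Integrable (fun x => (A₁.eval x + A₂.eval x * cauchyTransform ν₂ x) * x ^ k) ν₁ := by
  simp_rw [add_mul]
  exact (h.integrable_left A₁ k).add (h.integrable_right A₂ k)

lemma formMoment_add (h : NikishinData J Γ ν₁ ν₂) (A₁ A₂ B₁ B₂ : ℝ[X]) (k : ℕ) :
    formMoment ν₁ ν₂ (A₁ + B₁) (A₂ + B₂) k =
      formMoment ν₁ ν₂ A₁ A₂ k + formMoment ν₁ ν₂ B₁ B₂ k := by
  rw [formMoment, formMoment, formMoment,
    ← integral_add (h.integrable_form A₁ A₂ k) (h.integrable_form B₁ B₂ k)]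
  congr with x
  simp only [eval_add]
  ring

lemma formMoment_smul (c : ℝ) (A₁ A₂ : ℝ[X]) (k : ℕ) :
    formMoment ν₁ ν₂ (c • A₁) (c • A₂) k = c * formMoment ν₁ ν₂ A₁ A₂ k := by
  rw [formMoment, formMoment, ← integral_const_mul]
  congr with x
  simp only [eval_smul, smul_eq_mul]
  ring

lemma exists_nodes (h : NikishinData J Γ ν₁ ν₂) (A₁ A₂ : ℝ[X]) {M : ℕ}
    (horth : ∀ k < M, formMoment ν₁ ν₂ A₁ A₂ k = 0) :
    ∃ X : Finset ℝ, (∀ x ∈ X, x ∈ J) ∧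
      (∀ x ∈ X, A₁.eval x + A₂.eval x * cauchyTransform ν₂ x = 0) ∧ X.card = M :=
  exists_zeros_of_orthogonal h.ordConnected_nodes
    (A₁.continuous.continuousOn.add
      (A₂.continuous.continuousOn.mul (h.toCauchyData.continuousOn h.gap)))
    h.ae_mem_nodes h.not_finite_nodes (h.integrable_form A₁ A₂) horth

lemma exists_zeros_right (h : NikishinData J Γ ν₁ ν₂) {A₁ A₂ : ℝ[X]} {n₁ n₂ M : ℕ}
    (h₁ : A₁.degree < (n₁ : WithBot ℕ)) (h₂ : A₂.degree < (n₂ : WithBot ℕ)) (hn : n₂ ≤ n₁ + 1)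
    (hM : n₁ ≤ M) (hA : A₁ ≠ 0 ∨ A₂ ≠ 0) (horth : ∀ k < M, formMoment ν₁ ν₂ A₁ A₂ k = 0) :
    A₂ ≠ 0 ∧ ∃ T : Finset ℝ, (∀ z ∈ T, z ∈ interior Γ ∧ A₂.eval z = 0) ∧ M ≤ T.card + n₁ := by
  obtain ⟨X, hX, hL, rfl⟩ := h.exists_nodes A₁ A₂ horth
  have h0 : A₂ ≠ 0 := by
    rintro rfl
    exact (hA.resolve_right (by simp)) (eq_zero_of_degree_lt_of_card_le h₁ hM
      fun x hx => by simpa using hL x hx)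
  exact ⟨h0, h.toCauchyData.exists_zeros_right hX h₁ h₂ h0 hn hL⟩

lemma exists_zeros_left (h : NikishinData J Γ ν₁ ν₂) {A₁ A₂ : ℝ[X]} {n₁ n₂ M : ℕ}
    (h₁ : A₁.degree < (n₁ : WithBot ℕ)) (h₂ : A₂.degree < (n₂ : WithBot ℕ)) (hn : n₁ + 1 ≤ n₂)
    (hM : n₂ ≤ M) (hA : A₁ ≠ 0 ∨ A₂ ≠ 0) (horth : ∀ k < M, formMoment ν₁ ν₂ A₁ A₂ k = 0) :
    A₁ ≠ 0 ∧ ∃ T : Finset ℝ, (∀ z ∈ T, z ∈ interior Γ ∧ A₁.eval z = 0) ∧ M ≤ T.card + n₂ := by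
  obtain ⟨X, hX, hL, rfl⟩ := h.exists_nodes A₁ A₂ horth
  have h0 : A₁ ≠ 0 := by
    rintro rfl
    refine (hA.resolve_left (by simp)) (eq_zero_of_degree_lt_of_card_le h₂ hM fun x hx => ?_)
    simpa [h.toCauchyData.cauchyTransform_ne_zero (hX x hx)] using hL x hx
  exact ⟨h0, h.toCauchyData.exists_zeros_left h.infinite_nodes hX h₁ h₂ h0 hn hL⟩

/-- One vanishing moment more than in the type I conditions yields n₁ zeros of A₁, or n₂ of A₂, too
many for the degree. The two cases cover all indices. -/
lemma eq_zero_of_formMoment_eq_zero (h : NikishinData J Γ ν₁ ν₂) {A₁ A₂ : ℝ[X]} {n₁ n₂ : ℕ}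
    (h₁ : A₁.degree < (n₁ : WithBot ℕ)) (h₂ : A₂.degree < (n₂ : WithBot ℕ))
    (horth : ∀ k < n₁ + n₂, formMoment ν₁ ν₂ A₁ A₂ k = 0) : A₁ = 0 ∧ A₂ = 0 := by
  by_contra hne
  have hA : A₁ ≠ 0 ∨ A₂ ≠ 0 := by tauto
  rcases Nat.lt_or_ge n₁ n₂ with hn | hn
  · obtain ⟨h0, T, hT, hc⟩ := h.exists_zeros_left h₁ h₂ hn (by omega) hA horth
    have := card_lt_of_ne_zero h₁ h0 fun z hz => (hT z hz).2
    omega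
  · obtain ⟨h0, T, hT, hc⟩ := h.exists_zeros_right h₁ h₂ (by omega) (by omega) hA horth
    have := card_lt_of_ne_zero h₂ h0 fun z hz => (hT z hz).2
    omega

/-- The moment map is injective between spaces of equal dimension n₁ + n₂. -/
lemma exists_formMoment_eq (h : NikishinData J Γ ν₁ ν₂) (n₁ n₂ : ℕ) (c : ℕ → ℝ) :
    ∃ A₁ A₂ : ℝ[X], A₁.degree < (n₁ : WithBot ℕ) ∧ A₂.degree < (n₂ : WithBot ℕ) ∧
      ∀ k < n₁ + n₂, formMoment ν₁ ν₂ A₁ A₂ k = c k := by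
  let φ : (degreeLT ℝ n₁ × degreeLT ℝ n₂) →ₗ[ℝ] (Fin (n₁ + n₂) → ℝ) :=
    { toFun := fun p k => formMoment ν₁ ν₂ p.1 p.2 k
      map_add' := fun p q => by
        ext k
        exact h.formMoment_add _ _ _ _ _
      map_smul' := fun c p => by
        ext k
        exact formMoment_smul _ _ _ _ }
  have hd : Module.finrank ℝ (degreeLT ℝ n₁ × degreeLT ℝ n₂) =
      Module.finrank ℝ (Fin (n₁ + n₂) → ℝ) := by
    rw [Module.finrank_prod, (degreeLTEquiv ℝ n₁).finrank_eq, (degreeLTEquiv ℝ n₂).finrank_eq]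
    simp
  have : Module.Finite ℝ (degreeLT ℝ n₁) := Module.Finite.equiv (degreeLTEquiv ℝ n₁).symm
  have : Module.Finite ℝ (degreeLT ℝ n₂) := Module.Finite.equiv (degreeLTEquiv ℝ n₂).symm
  have hinj : Function.Injective φ := by
    rw [← LinearMap.ker_eq_bot, LinearMap.ker_eq_bot']
    rintro ⟨⟨A₁, h₁⟩, ⟨A₂, h₂⟩⟩ hA
    obtain ⟨rfl, rfl⟩ := h.eq_zero_of_formMoment_eq_zero (mem_degreeLT.1 h₁) (mem_degreeLT.1 h₂)
      fun k hk => congrFun hA ⟨k, hk⟩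
    rfl
  obtain ⟨⟨⟨A₁, h₁⟩, ⟨A₂, h₂⟩⟩, hA⟩ :=
    (LinearMap.injective_iff_surjective_of_finrank_eq_finrank hd).1 hinj fun k => c k
  exact ⟨A₁, A₂, mem_degreeLT.1 h₁, mem_degreeLT.1 h₂, fun k hk => congrFun hA ⟨k, hk⟩⟩

end NikishinData

/-! ### Passage between real and complex polynomials -/

/-- A real polynomial of degree less than `n` with `n - 1` zeros in `I` has only simple zeros, all
of them in `I`, as a complex polynomial. -/
lemma zeros_of_card_add_one_ge {p : ℝ[X]} (h0 : p ≠ 0) {n : ℕ} (hp : p.degree < (n : WithBot ℕ))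
    {I : Set ℝ} {T : Finset ℝ} (hT : ∀ z ∈ T, z ∈ I ∧ p.eval z = 0) (hc : n ≤ T.card + 1) :
    zeroSet (p.map (algebraMap ℝ ℂ)) ⊆ ((↑) : ℝ → ℂ) '' I ∧
      SimpleZeros (p.map (algebraMap ℝ ℂ)) := by
  classical
  obtain ⟨c, hc0, rfl⟩ := exists_eq_C_mul_nodePoly h0
    (hp.trans_le (by exact_mod_cast hc)) fun z hz => (hT z hz).2
  have hz : ∀ z ∈ zeroSet ((C c * nodePoly T).map (algebraMap ℝ ℂ)), ∃ x ∈ T, (x : ℂ) = z := by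
    intro z hz
    have hz' : ((C c * nodePoly T).map (algebraMap ℝ ℂ)).eval z = 0 := hz
    simp only [nodePoly, Polynomial.map_mul, Polynomial.map_prod, eval_mul, eval_prod, map_C,
      eval_C, Polynomial.map_sub, map_X, eval_sub, eval_X, mul_eq_zero,
      Finset.prod_eq_zero_iff] at hz'
    rcases hz' with h | ⟨x, hx, h⟩
    · simp [hc0] at h
    · exact ⟨x, hx, (sub_eq_zero.1 h).symm⟩
  refine ⟨fun z hzz => ?_, fun z hzz => ?_⟩
  · obtain ⟨x, hx, rfl⟩ := hz z hzz
    exact ⟨x, (hT x hx).1, rfl⟩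
  · obtain ⟨x, hx, rfl⟩ := hz z hzz
    have h1 : (C c * nodePoly T).rootMultiplicity x = 1 := by
      have hne : C c * nodePoly T ≠ 0 := h0
      have hfac : C c * nodePoly T = (Polynomial.X - C x) * (C c * nodePoly (T.erase x)) := by
        rw [nodePoly, nodePoly, ← Finset.mul_prod_erase T _ hx]
        ring
      have hr : ¬ (C c * nodePoly (T.erase x)).IsRoot x := by
        simp [IsRoot.def, hc0, eval_nodePoly_eq_zero_iff]
      rw [hfac] at hne ⊢
      rw [rootMultiplicity_mul hne, rootMultiplicity_X_sub_C_self, rootMultiplicity_eq_zero hr]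
    rw [← h1]
    exact (eq_rootMultiplicity_map (algebraMap ℝ ℂ).injective x).symm

lemma exists_eq_map_add_I_mul_map (p : ℂ[X]) : ∃ a b : ℝ[X], a.degree ≤ p.degree ∧
    b.degree ≤ p.degree ∧ p = a.map (algebraMap ℝ ℂ) + C Complex.I * b.map (algebraMap ℝ ℂ) := by
  have key : ∀ f : ℂ → ℝ, f 0 = 0 → ∃ a : ℝ[X], ∀ i, a.coeff i = f (p.coeff i) := fun f hf =>
    ⟨∑ i ∈ Finset.range (p.natDegree + 1), monomial i (f (p.coeff i)), fun i => by
      simp only [finsetSum_coeff, coeff_monomial, Finset.sum_ite_eq', Finset.mem_range]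
      split_ifs with hi
      · rfl
      · rw [coeff_eq_zero_of_natDegree_lt (by omega), hf]⟩
  obtain ⟨a, ha⟩ := key Complex.re rfl
  obtain ⟨b, hb⟩ := key Complex.im rfl
  refine ⟨a, b, ?_, ?_, ?_⟩
  · refine (degree_le_iff_coeff_zero _ _).2 fun i hi => ?_
    rw [ha, coeff_eq_zero_of_degree_lt hi, Complex.zero_re]
  · refine (degree_le_iff_coeff_zero _ _).2 fun i hi => ?_
    rw [hb, coeff_eq_zero_of_degree_lt hi, Complex.zero_im]
  · ext i
    rw [coeff_add, coeff_C_mul, coeff_map, coeff_map, ha, hb]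
    exact ((Complex.re_add_im _).symm.trans (by rw [mul_comm]; rfl))

/-! ### Reduction of signed generators to positive measures -/

lemma Set.OrdConnected.interior_nonempty_of_infinite {Γ : Set ℝ} (hΓ : Γ.OrdConnected)
    (hinf : Γ.Infinite) : (interior Γ).Nonempty := by
  obtain ⟨a, ha, b, hb, hab⟩ := hinf.nontrivial.exists_lt
  obtain ⟨c, hac, hcb⟩ := exists_between hab
  exact ⟨c, hΓ.mem_interior_of_lt_of_lt ha hb hac hcb⟩

lemma Set.OrdConnected.subset_closure_interior {Γ : Set ℝ} (hΓ : Γ.OrdConnected)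
    (hinf : Γ.Infinite) : Γ ⊆ closure (interior Γ) := by
  have hconv : Convex ℝ Γ := hΓ.convex
  rw [hconv.closure_interior_eq_closure_of_nonempty_interior
    (hΓ.interior_nonempty_of_infinite hinf)]
  exact subset_closure

/-- An infinite interval lies in the closure of its interior, so an open set meeting it meets its
interior. A one-point interval would be a counterexample. -/
lemma notMem_interior_of_disjoint {Γ Γ' : Set ℝ} (hΓ : Γ.OrdConnected) (hinf : Γ.Infinite)
    (hd : interior Γ ∩ interior Γ' = ∅) {x : ℝ} (hx : x ∈ Γ) : x ∉ interior Γ' := fun hx' => by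
  obtain ⟨y, hy', hy⟩ := mem_closure_iff.1 (hΓ.subset_closure_interior hinf hx) _
    isOpen_interior hx'
  exact Set.notMem_empty y (hd ▸ ⟨hy, hy'⟩)

lemma not_ae_mem_finset_of_infinite_support {ν : Measure ℝ} (h : ν.support.Infinite)
    (F : Finset ℝ) : ¬ ∀ᵐ t ∂ν, t ∈ F := fun hF =>
  h (F.finite_toSet.subset (Measure.support_subset_of_isClosed F.finite_toSet.isClosed hF))

namespace MemM

variable {Γ : Set ℝ} {σ : SignedMeasure ℝ}

lemma infinite (h : MemM Γ σ) : Γ.Infinite := h.support_infinite.mono h.support_subset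

lemma ae_mem (h : MemM Γ σ) : ∀ᵐ t ∂σ.variation, t ∈ Γ := by
  filter_upwards [Measure.support_mem_ae (μ := σ.variation)] with t ht using h.support_subset ht

lemma exists_eq_smul (h : MemM Γ σ) : ∃ ε : ℝ, (ε = 1 ∨ ε = -1) ∧
    ∃ (ν : Measure ℝ) (_ : IsFiniteMeasure ν), σ.variation = ν ∧ σ = ε • ν.toSignedMeasure := by
  rcases h.constant_sign with h0 | h0
  · have h0' : 0 ≤[Set.univ] σ := (VectorMeasure.le_restrict_univ_iff_le _ _).2 h0
    have := SignedMeasure.toMeasureOfZeroLE_toSignedMeasure σ h0'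
    refine ⟨1, Or.inl rfl, σ.toMeasureOfZeroLE Set.univ MeasurableSet.univ h0', inferInstance, ?_, ?_⟩
    · rw [← Measure.variation_toSignedMeasure (μ := σ.toMeasureOfZeroLE _ _ _), this]
    · rw [one_smul, this]
  · have h0' : σ ≤[Set.univ] 0 := (VectorMeasure.le_restrict_univ_iff_le _ _).2 h0
    have := SignedMeasure.toMeasureOfLEZero_toSignedMeasure σ h0'
    refine ⟨-1, Or.inr rfl, σ.toMeasureOfLEZero Set.univ MeasurableSet.univ h0', inferInstance, ?_, ?_⟩
    · rw [← Measure.variation_toSignedMeasure (μ := σ.toMeasureOfLEZero _ _ _), this, variation_neg]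
    · rw [this]
      simp

end MemM

lemma integral_smul_toSignedMeasure {E : Type*} [NormedAddCommGroup E] [NormedSpace ℝ E]
    {ν : Measure ℝ} [IsFiniteMeasure ν] (ε : ℝ) (f : ℝ → E) :
    ∫ᵛ x, f x ∂<•(ε • ν.toSignedMeasure) = ε • ∫ x, f x ∂ν := by
  rw [integral_smul_vectorMeasure, integral_toSignedMeasure]

section Cauchy

variable {ν : Measure ℝ} {x : ℝ}

lemma measurable_enorm_sub_inv : Measurable fun p : ℝ × ℝ => ‖p.2 - p.1‖ₑ⁻¹ :=
  (measurable_snd.sub measurable_fst).enorm.inv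

lemma enorm_inv_le (t : ℝ) : ‖t⁻¹‖ₑ ≤ ‖t‖ₑ⁻¹ := by
  rcases eq_or_ne t 0 with rfl | ht
  · simp
  · rw [enorm_inv ht]

lemma integrable_inv_sub_of_lintegral_lt_top (h : ∫⁻ t, ‖t - x‖ₑ⁻¹ ∂ν < ∞) :
    Integrable (fun t => (t - x)⁻¹) ν :=
  ⟨(measurable_id.sub_const x).inv.aestronglyMeasurable,
    (lintegral_mono fun t => enorm_inv_le (t - x)).trans_lt h⟩

/-- The integrand is ∞ at t = x, so an atom there would make the integral infinite. -/
lemma measure_singleton_eq_zero_of_lintegral_lt_top (h : ∫⁻ t, ‖t - x‖ₑ⁻¹ ∂ν < ∞) :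
    ν {x} = 0 := by
  have := ae_lt_top (measurable_enorm_sub_inv.comp measurable_prodMk_left) h.ne
  rw [ae_iff] at this
  refine measure_mono_null ?_ this
  rintro t rfl
  simp

lemma stronglyMeasurable_cauchyTransform [SFinite ν] :
    StronglyMeasurable (cauchyTransform ν) :=
  StronglyMeasurable.integral_prod_right (f := fun x t : ℝ => (t - x)⁻¹)
    (measurable_snd.sub measurable_fst).inv.stronglyMeasurable

lemma integrable_cauchyTransform [SFinite ν] {ν' : Measure ℝ}
    (h : ∫⁻ x, ∫⁻ t, ‖t - x‖ₑ⁻¹ ∂ν ∂ν' < ∞) : Integrable (cauchyTransform ν) ν' :=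
  ⟨stronglyMeasurable_cauchyTransform.aestronglyMeasurable,
    (lintegral_mono fun x => (enorm_integral_le_lintegral_enorm _).trans
      (lintegral_mono fun t => enorm_inv_le (t - x))).trans_lt h⟩

end Cauchy

/-- A density of constant sign δ only contributes a scalar, which exhibits the signed measure as a
multiple of a positive one and makes its variation computable. -/
lemma withDensity_smul_toSignedMeasure {ν : Measure ℝ} [IsFiniteMeasure ν] {f : ℝ → ℝ}
    (hf : Integrable f ν) {ε δ : ℝ} (hδ : ∀ᵐ x ∂ν, f x = δ * |f x|)
    [IsFiniteMeasure (ν.withDensity fun x => ‖f x‖ₑ)] :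
    (ε • ν.toSignedMeasure).withDensity f (lsmul ℝ ℝ).flip =
      (ε * δ) • (ν.withDensity fun x => ‖f x‖ₑ).toSignedMeasure := by
  have hint : (ε • ν.toSignedMeasure).Integrable f :=
    Integrable.smul_vectorMeasure (μ := ν.toSignedMeasure)
      (by simpa [VectorMeasure.Integrable] using hf) ε
  ext s hs
  rw [VectorMeasure.withDensity_apply hint, restrict_smul, integral_smul_vectorMeasure,
    setIntegral_toSignedMeasure hs, smul_apply,
    Measure.toSignedMeasure_apply_measurable hs, measureReal_def, MeasureTheory.withDensity_apply _ hs,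
    ← integral_norm_eq_lintegral_enorm hf.aestronglyMeasurable.restrict, mul_smul]
  congr 1
  rw [smul_eq_mul, ← integral_const_mul]
  refine integral_congr_ae (ae_restrict_of_ae ?_)
  filter_upwards [hδ] with x hx using hx

theorem IsNikishin.exists_data {Γ₁ Γ₂ : Set ℝ} {σ₁ σ₂ μ₁ μ₂ : SignedMeasure ℝ}
    (h : IsNikishin Γ₁ Γ₂ σ₁ σ₂ μ₁ μ₂) :
    ∃ (J : Set ℝ) (ν₁ ν₂ : Measure ℝ) (c₁ c₂ : ℝ), NikishinData J Γ₂ ν₁ ν₂ ∧ c₁ ≠ 0 ∧ c₂ ≠ 0 ∧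
      (∀ f : ℝ → ℂ, ∫ᵛ x, f x ∂<•μ₁ = c₁ • ∫ x, f x ∂ν₁) ∧
      (∀ f : ℝ → ℂ, ∫ᵛ x, f x ∂<•μ₂ = c₂ • ∫ x, cauchyTransform ν₂ x • f x ∂ν₁) := by
  obtain ⟨ε₁, hε₁, ν₁, _, hν₁, h₁⟩ := h.memM_σ₁.exists_eq_smul
  obtain ⟨ε₂, hε₂, ν₂, _, hν₂, h₂⟩ := h.memM_σ₂.exists_eq_smul
  have hε₁0 : ε₁ ≠ 0 := by rcases hε₁ with rfl | rfl <;> norm_num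
  have hfin : ∫⁻ x, ∫⁻ t, ‖t - x‖ₑ⁻¹ ∂ν₂ ∂ν₁ < ∞ := by
    rw [← hν₁, ← hν₂]
    exact h.finite
  have hae₁ := h.memM_σ₁.ae_mem
  have hae₂ := h.memM_σ₂.ae_mem
  have hsupp₁ := h.memM_σ₁.support_infinite
  have hsupp₂ := h.memM_σ₂.support_infinite
  have hmom₁ := h.memM_μ₁.moments
  have hmom₂ := h.memM_μ₂.moments
  rw [hν₁] at hae₁ hsupp₁
  rw [hν₂] at hae₂ hsupp₂
  simp only [VectorMeasure.Integrable, h.eq₁, hν₁] at hmom₁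
  -- Γ₁ and Γ₂ may share an endpoint, where m can diverge, so the nodes are restricted to a subset
  -- of full `ν₁`-measure. The atom condition is separate because `(t - x)⁻¹` is 0 at t = x and
  -- integrability alone would miss it.
  set J : Set ℝ := {x | x ∈ Γ₁ ∧ Integrable (fun t => (t - x)⁻¹) ν₂ ∧ ν₂ {x} = 0}
  have hΓ₁ := h.interval₁.2
  have hΓ₂ := h.interval₂.2
  have hinf₁ := h.memM_σ₁.infinite
  have hinf₂ := h.memM_σ₂.infinite
  have hgap : ∀ a ∈ Γ₁, ∀ b ∈ Γ₁, ∀ t ∈ Γ₂, t ∉ Set.Ioo a b := fun a ha b hb t ht htab =>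
    notMem_interior_of_disjoint hΓ₂ hinf₂ (by rw [Set.inter_comm]; exact h.disjoint_interior) ht
      (hΓ₁.mem_interior_of_lt_of_lt ha hb htab.1 htab.2)
  have hC : CauchyData J Γ₂ ν₂ :=
    { ordConnected := hΓ₂
      interior_nonempty := hΓ₂.interior_nonempty_of_infinite hinf₂
      subset_closure := hΓ₂.subset_closure_interior hinf₂
      ae_mem := hae₂
      not_finite := not_ae_mem_finset_of_infinite_support hsupp₂
      notMem_interior := fun x hx =>
        notMem_interior_of_disjoint hΓ₁ hinf₁ h.disjoint_interior hx.1
      integrable := fun x hx => hx.2.1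
      null := fun x hx => hx.2.2 }
  have hJord : J.OrdConnected := by
    refine ⟨fun a ha b hb y hy => ?_⟩
    rcases hy.1.eq_or_lt with rfl | hay
    · exact ha
    rcases hy.2.eq_or_lt with rfl | hyb
    · exact hb
    have hne : ∀ c ∈ J, ∀ᵐ t ∂ν₂, t ≠ c := fun c hc => by
      rw [ae_iff]
      simpa using hc.2.2
    refine ⟨hΓ₁.out ha.1 hb.1 hy, ?_, ?_⟩
    · refine (ha.2.1.abs.add hb.2.1.abs).mono'
        (measurable_id.sub_const y).inv.aestronglyMeasurable ?_
      filter_upwards [hC.ae_mem, hne a ha, hne b hb] with t ht hta htb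
      exact abs_inv_sub_le hy (hgap a ha.1 b hb.1 t ht) hta htb
    · refine measure_mono_null ?_ (ae_iff.1 hC.ae_mem)
      rintro t rfl
      exact fun ht => hgap a ha.1 b hb.1 t ht ⟨hay, hyb⟩
  have hJgap : ∀ a ∈ J, ∀ b ∈ J, ∀ t ∈ Γ₂, t ∉ Set.Ioo a b :=
    fun a ha b hb => hgap a ha.1 b hb.1
  have hJae : ∀ᵐ x ∂ν₁, x ∈ J := by
    filter_upwards [hae₁, ae_lt_top measurable_enorm_sub_inv.lintegral_prod_right'
      hfin.ne] with x hx hx'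
    exact ⟨hx, integrable_inv_sub_of_lintegral_lt_top hx',
      measure_singleton_eq_zero_of_lintegral_lt_top hx'⟩
  obtain ⟨δ, hδ, hδm⟩ := exists_sign_of_ne_zero hJord (hC.continuousOn hJgap)
    fun x hx => hC.cauchyTransform_ne_zero hx
  have hint : Integrable (cauchyTransform ν₂) ν₁ := integrable_cauchyTransform hfin
  have hδ' : ∀ᵐ x ∂ν₁, cauchyTransform ν₂ x = δ * |cauchyTransform ν₂ x| := by
    filter_upwards [hJae] with x hx
    have := hδm x hx
    rcases hδ with rfl | rfl
    · rw [abs_of_pos (by linarith)]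
      ring
    · rw [abs_of_neg (by linarith)]
      ring
  have : IsFiniteMeasure (ν₁.withDensity fun x => ‖cauchyTransform ν₂ x‖ₑ) :=
    ⟨by simpa using! hint.2⟩
  have hm : mFunction σ₂ = fun x => ε₂ * cauchyTransform ν₂ x := by
    ext x
    rw [mFunction, h₂, integral_smul_toSignedMeasure, smul_eq_mul, cauchyTransform]
  have hμ₂ : μ₂ = (ε₁ * (ε₂ * δ)) •
      (ν₁.withDensity fun x => ‖cauchyTransform ν₂ x‖ₑ).toSignedMeasure := by
    have hen : (fun x => ‖ε₂ * cauchyTransform ν₂ x‖ₑ) = fun x => ‖cauchyTransform ν₂ x‖ₑ := by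
      ext x
      rcases hε₂ with rfl | rfl <;> simp
    have : IsFiniteMeasure (ν₁.withDensity fun x => ‖ε₂ * cauchyTransform ν₂ x‖ₑ) := by
      rw [hen]
      infer_instance
    have hden := withDensity_smul_toSignedMeasure (ν := ν₁) (ε := ε₁) (δ := ε₂ * δ)
      (hint.const_mul ε₂) (by
        filter_upwards [hδ'] with x hx
        have : |ε₂| = 1 := by rcases hε₂ with rfl | rfl <;> simp
        rw [abs_mul, this, one_mul, mul_assoc, ← hx])
    rw [h.eq₂, bracket, hm, h₁, hden]
    simp only [hen]
  have hκ : ε₁ * (ε₂ * δ) = 1 ∨ ε₁ * (ε₂ * δ) = -1 := by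
    rcases hε₁ with rfl | rfl <;> rcases hε₂ with rfl | rfl <;> rcases hδ with rfl | rfl <;> simp
  have hκ0 : ε₁ * (ε₂ * δ) ≠ 0 := by rcases hκ with e | e <;> rw [e] <;> norm_num
  have hmeas : AEMeasurable (fun x => ‖cauchyTransform ν₂ x‖ₑ) ν₁ :=
    hint.aestronglyMeasurable.enorm
  have htop : ∀ᵐ x ∂ν₁, ‖cauchyTransform ν₂ x‖ₑ < ∞ := Filter.Eventually.of_forall fun x => enorm_lt_top
  have hvar : μ₂.variation = ν₁.withDensity fun x => ‖cauchyTransform ν₂ x‖ₑ := by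
    rw [hμ₂, variation_smul, Measure.variation_toSignedMeasure]
    rcases hκ with e | e <;> rw [e] <;> simp
  have hmomC : ∀ k : ℕ, Integrable (fun x => cauchyTransform ν₂ x * x ^ k) ν₁ := fun k => by
    have hk := hmom₂ k
    rw [VectorMeasure.Integrable, hvar,
      integrable_withDensity_iff_integrable_smul₀' hmeas htop] at hk
    -- The moments of μ₂ are taken against the variation, whose density is |m|; the factor δ
    -- restores the sign of m.
    refine (hk.const_mul δ).congr ?_
    filter_upwards [hδ'] with x hx
    rw [toReal_enorm, Real.norm_eq_abs, smul_eq_mul, ← mul_assoc, ← hx]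
  refine ⟨J, ν₁, ν₂, ε₁, ε₁ * ε₂, ⟨hC, hJord, hJgap, hJae,
    not_ae_mem_finset_of_infinite_support hsupp₁, hmom₁, hmomC⟩, hε₁0,
    by rcases hε₁ with rfl | rfl <;> rcases hε₂ with rfl | rfl <;> simp, fun f => ?_, fun f => ?_⟩
  · rw [h.eq₁, h₁, integral_smul_toSignedMeasure]
  · rw [hμ₂, integral_smul_toSignedMeasure,
      integral_withDensity_eq_integral_toReal_smul₀ hmeas htop, ← mul_assoc, mul_smul,
      ← MeasureTheory.integral_smul]
    congr 1
    refine integral_congr_ae ?_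
    filter_upwards [hδ'] with x hx
    rw [toReal_enorm, Real.norm_eq_abs, smul_smul, ← hx]

/-! ### Type I conditions as real moment equations -/

lemma eval_map_ofReal (p : ℝ[X]) (x : ℝ) :
    (p.map (algebraMap ℝ ℂ)).eval (x : ℂ) = ((p.eval x : ℝ) : ℂ) := by
  rw [eval_map, ← Complex.coe_algebraMap, eval₂_at_apply]

lemma integral_ofReal_add_I_mul {ν : Measure ℝ} {f g : ℝ → ℝ} (hf : Integrable f ν)
    (hg : Integrable g ν) :
    ∫ x, ((f x : ℂ) + Complex.I * (g x : ℂ)) ∂ν =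
      ((∫ x, f x ∂ν : ℝ) : ℂ) + Complex.I * ((∫ x, g x ∂ν : ℝ) : ℂ) := by
  rw [MeasureTheory.integral_add hf.ofReal (hg.ofReal.const_mul _), integral_const_mul]
  simp only [integral_complex_ofReal]

namespace NikishinData

variable {J Γ : Set ℝ} {ν₁ ν₂ : Measure ℝ}

/-- The moments of a complex linear form, by real and imaginary parts. -/
lemma smul_integral_add_smul_integral (h : NikishinData J Γ ν₁ ν₂) (c₁ c₂ : ℝ) {A B : ℂ[X]}
    {a₁ a₂ b₁ b₂ : ℝ[X]}
    (hA : A = a₁.map (algebraMap ℝ ℂ) + C Complex.I * a₂.map (algebraMap ℝ ℂ))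
    (hB : B = b₁.map (algebraMap ℝ ℂ) + C Complex.I * b₂.map (algebraMap ℝ ℂ)) (k : ℕ) :
    c₁ • (∫ x : ℝ, A.eval (x : ℂ) * (x : ℂ) ^ k ∂ν₁) +
      c₂ • ∫ x : ℝ, cauchyTransform ν₂ x • (B.eval (x : ℂ) * (x : ℂ) ^ k) ∂ν₁ =
      (formMoment ν₁ ν₂ (c₁ • a₁) (c₂ • b₁) k : ℂ) +
        Complex.I * (formMoment ν₁ ν₂ (c₁ • a₂) (c₂ • b₂) k : ℂ) := by
  have key : ∀ a b : ℝ[X], formMoment ν₁ ν₂ (c₁ • a) (c₂ • b) k =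
      c₁ * (∫ x, a.eval x * x ^ k ∂ν₁) +
        c₂ * ∫ x, b.eval x * cauchyTransform ν₂ x * x ^ k ∂ν₁ := fun a b => by
    rw [formMoment, ← integral_const_mul, ← integral_const_mul, ← MeasureTheory.integral_add
      ((h.integrable_left a k).const_mul _) ((h.integrable_right b k).const_mul _)]
    congr with x
    simp only [eval_smul, smul_eq_mul]
    ring
  have h1 : ∫ x : ℝ, A.eval (x : ℂ) * (x : ℂ) ^ k ∂ν₁ =
      ∫ x, (((a₁.eval x * x ^ k : ℝ) : ℂ) + Complex.I * ((a₂.eval x * x ^ k : ℝ) : ℂ)) ∂ν₁ := by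
    congr with x
    rw [hA, eval_add, eval_mul, eval_C, eval_map_ofReal, eval_map_ofReal]
    push_cast
    ring
  have h2 : ∫ x : ℝ, cauchyTransform ν₂ x • (B.eval (x : ℂ) * (x : ℂ) ^ k) ∂ν₁ =
      ∫ x, (((b₁.eval x * cauchyTransform ν₂ x * x ^ k : ℝ) : ℂ) +
        Complex.I * ((b₂.eval x * cauchyTransform ν₂ x * x ^ k : ℝ) : ℂ)) ∂ν₁ := by
    congr with x
    rw [hB, eval_add, eval_mul, eval_C, eval_map_ofReal, eval_map_ofReal, Complex.real_smul]
    push_cast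
    ring
  rw [h1, h2, integral_ofReal_add_I_mul (h.integrable_left _ _) (h.integrable_left _ _),
    integral_ofReal_add_I_mul (h.integrable_right _ _) (h.integrable_right _ _), key, key,
    Complex.real_smul, Complex.real_smul]
  push_cast
  ring

end NikishinData

section TypeI

variable {J Γ : Set ℝ} {ν₁ ν₂ : Measure ℝ} {c₁ c₂ : ℝ} {μ₁ μ₂ : SignedMeasure ℝ} {n₁ n₂ : ℕ}

/-- For a Nikishin system, the type I conditions are equations between real moments. -/
lemma isTypeI_iff (h : NikishinData J Γ ν₁ ν₂)
    (hμ₁ : ∀ f : ℝ → ℂ, ∫ᵛ x, f x ∂<•μ₁ = c₁ • ∫ x, f x ∂ν₁)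
    (hμ₂ : ∀ f : ℝ → ℂ, ∫ᵛ x, f x ∂<•μ₂ = c₂ • ∫ x, cauchyTransform ν₂ x • f x ∂ν₁)
    (hn : n₁ + n₂ ≠ 0) {A : Fin 2 → ℂ[X]} {a₁ a₂ b₁ b₂ : ℝ[X]}
    (hA : A 0 = a₁.map (algebraMap ℝ ℂ) + C Complex.I * a₂.map (algebraMap ℝ ℂ))
    (hB : A 1 = b₁.map (algebraMap ℝ ℂ) + C Complex.I * b₂.map (algebraMap ℝ ℂ)) :
    IsTypeI ![μ₁, μ₂] ![n₁, n₂] A ↔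
      (A 0).degree < (n₁ : WithBot ℕ) ∧ (A 1).degree < (n₂ : WithBot ℕ) ∧
      ∀ k < n₁ + n₂, formMoment ν₁ ν₂ (c₁ • a₁) (c₂ • b₁) k = (if k + 1 = n₁ + n₂ then 1 else 0) ∧
        formMoment ν₁ ν₂ (c₁ • a₂) (c₂ • b₂) k = 0 := by
  have hsum : ∀ k : ℕ, ∑ j : Fin 2, ∫ᵛ x : ℝ, (A j).eval (x : ℂ) * (x : ℂ) ^ k
      ∂<•(![μ₁, μ₂] j) = (formMoment ν₁ ν₂ (c₁ • a₁) (c₂ • b₁) k : ℂ) +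
        Complex.I * (formMoment ν₁ ν₂ (c₁ • a₂) (c₂ • b₂) k : ℂ) := fun k => by
    rw [← h.smul_integral_add_smul_integral c₁ c₂ hA hB, Fin.sum_univ_two]
    simp only [Matrix.cons_val_zero, Matrix.cons_val_one]
    rw [hμ₁, hμ₂]
  have hn' : ∑ j : Fin 2, ![n₁, n₂] j = n₁ + n₂ := by simp
  have hre : ∀ u v w : ℝ, (u : ℂ) + Complex.I * (v : ℂ) = (w : ℂ) ↔ u = w ∧ v = 0 :=
    fun u v w => by simp [Complex.ext_iff]
  constructor
  · intro hT
    refine ⟨hT.degree_lt 0, hT.degree_lt 1, fun k hk => ?_⟩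
    rw [← hre, ← hsum]
    split_ifs with hk'
    · rw [hT.normalized k (by rw [hn', hk']), Complex.ofReal_one]
    · rw [hT.orthogonal k (by rw [hn']; omega), Complex.ofReal_zero]
  · rintro ⟨h0, h1, hk⟩
    refine ⟨?_, Fin.forall_fin_two.2 ⟨h0, h1⟩, fun k hk' => ?_, fun k hk' => ?_⟩
    -- The zero vector fails the normalization at k = |n| - 1, an index that exists because |n| ≠ 0.
    · rintro rfl
      obtain ⟨hm, -⟩ := hk (n₁ + n₂ - 1) (by omega)
      have := hsum (n₁ + n₂ - 1)
      rw [hm, (hk (n₁ + n₂ - 1) (by omega)).2, if_pos (by omega)] at this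
      simp at this
    · rw [hn'] at hk'
      rw [hsum, (hk k (by omega)).1, (hk k (by omega)).2, if_neg (by omega)]
      simp
    · rw [hn'] at hk'
      rw [hsum, (hk k (by omega)).1, (hk k (by omega)).2, if_pos hk']
      simp

/-- At every nonzero multi-index there is a unique type I polynomial, and it is real. -/
lemma existsUnique_isTypeI (h : NikishinData J Γ ν₁ ν₂) (hc₁ : c₁ ≠ 0) (hc₂ : c₂ ≠ 0)
    (hμ₁ : ∀ f : ℝ → ℂ, ∫ᵛ x, f x ∂<•μ₁ = c₁ • ∫ x, f x ∂ν₁)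
    (hμ₂ : ∀ f : ℝ → ℂ, ∫ᵛ x, f x ∂<•μ₂ = c₂ • ∫ x, cauchyTransform ν₂ x • f x ∂ν₁)
    (hn : n₁ + n₂ ≠ 0) : ∃ r₁ r₂ : ℝ[X], r₁.degree < (n₁ : WithBot ℕ) ∧
      r₂.degree < (n₂ : WithBot ℕ) ∧
      (∀ k < n₁ + n₂, formMoment ν₁ ν₂ (c₁ • r₁) (c₂ • r₂) k = if k + 1 = n₁ + n₂ then 1 else 0) ∧
      ∀ A : Fin 2 → ℂ[X], IsTypeI ![μ₁, μ₂] ![n₁, n₂] A ↔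
        A = ![r₁.map (algebraMap ℝ ℂ), r₂.map (algebraMap ℝ ℂ)] := by
  have hdeg : ∀ {c : ℝ} {p : ℝ[X]} {n : ℕ}, p.degree < (n : WithBot ℕ) →
      (c • p).degree < (n : WithBot ℕ) := fun hp => (degree_smul_le _ _).trans_lt hp
  obtain ⟨s₁, s₂, hs₁, hs₂, hs⟩ := h.exists_formMoment_eq n₁ n₂
    fun k => if k + 1 = n₁ + n₂ then 1 else 0
  have e₁ : c₁ • c₁⁻¹ • s₁ = s₁ := smul_inv_smul₀ hc₁ s₁
  have e₂ : c₂ • c₂⁻¹ • s₂ = s₂ := smul_inv_smul₀ hc₂ s₂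
  refine ⟨c₁⁻¹ • s₁, c₂⁻¹ • s₂, hdeg hs₁, hdeg hs₂, by rwa [e₁, e₂], fun A => ⟨fun hA => ?_, ?_⟩⟩
  · obtain ⟨a₁, a₂, ha₁, ha₂, haA⟩ := exists_eq_map_add_I_mul_map (A 0)
    obtain ⟨b₁, b₂, hb₁, hb₂, hbA⟩ := exists_eq_map_add_I_mul_map (A 1)
    obtain ⟨hd₁, hd₂, hk⟩ := (isTypeI_iff h hμ₁ hμ₂ hn haA hbA).1 hA
    -- The imaginary parts solve the homogeneous problem, and so does the difference of the real
    -- parts from the constructed solution.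
    obtain ⟨h1, h2⟩ := h.eq_zero_of_formMoment_eq_zero (hdeg (c := c₁) (ha₂.trans_lt hd₁))
      (hdeg (c := c₂) (hb₂.trans_lt hd₂)) fun k hk' => (hk k hk').2
    obtain ⟨h3, h4⟩ := h.eq_zero_of_formMoment_eq_zero
      (A₁ := c₁ • a₁ + (-1 : ℝ) • s₁) (A₂ := c₂ • b₁ + (-1 : ℝ) • s₂)
      ((degree_add_le _ _).trans_lt (max_lt (hdeg (ha₁.trans_lt hd₁)) (hdeg hs₁)))
      ((degree_add_le _ _).trans_lt (max_lt (hdeg (hb₁.trans_lt hd₂)) (hdeg hs₂)))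
      fun k hk' => by
        rw [h.formMoment_add, NikishinData.formMoment_smul, (hk k hk').1, hs k hk']
        ring
    have h1' : a₂ = 0 := (smul_eq_zero.1 h1).resolve_left hc₁
    have h2' : b₂ = 0 := (smul_eq_zero.1 h2).resolve_left hc₂
    have h3' : a₁ = c₁⁻¹ • s₁ := by
      rw [eq_inv_smul_iff₀ hc₁, ← sub_eq_zero, ← h3]
      simp [sub_eq_add_neg]
    have h4' : b₁ = c₂⁻¹ • s₂ := by
      rw [eq_inv_smul_iff₀ hc₂, ← sub_eq_zero, ← h4]
      simp [sub_eq_add_neg]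
    ext1 j
    fin_cases j
    · simpa [h1', h3'] using haA
    · simpa [h2', h4'] using hbA
  · rintro rfl
    rw [isTypeI_iff (a₁ := c₁⁻¹ • s₁) (a₂ := 0) (b₁ := c₂⁻¹ • s₂) (b₂ := 0) h hμ₁ hμ₂ hn
      (by simp) (by simp)]
    refine ⟨degree_map_le.trans_lt (hdeg hs₁), degree_map_le.trans_lt (hdeg hs₂), fun k hk => ⟨?_, ?_⟩⟩
    · rw [e₁, e₂, hs k hk]
    · simp [formMoment]

end TypeI

theorem mainTheorem5 (Γ₁ Γ₂ : Set ℝ) (σ₁ σ₂ μ₁ μ₂ : SignedMeasure ℝ)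
    (h : IsNikishin Γ₁ Γ₂ σ₁ σ₂ μ₁ μ₂) (n₁ n₂ : ℕ) :
    (n₁ + 1 ≤ n₂ → n₁ ≠ 0 →
      (∃! A : Fin 2 → ℂ[X], IsTypeI ![μ₁, μ₂] ![n₁, n₂] A) ∧
      ∀ A : Fin 2 → ℂ[X], IsTypeI ![μ₁, μ₂] ![n₁, n₂] A →
        RealRooted (A 0) ∧
        zeroSet (A 0) ⊆ ((↑) : ℝ → ℂ) '' interior Γ₂ ∧
        SimpleZeros (A 0)) ∧
    (n₁ + 1 ≥ n₂ → n₂ ≠ 0 →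
      (∃! A : Fin 2 → ℂ[X], IsTypeI ![μ₁, μ₂] ![n₁, n₂] A) ∧
      ∀ A : Fin 2 → ℂ[X], IsTypeI ![μ₁, μ₂] ![n₁, n₂] A →
        RealRooted (A 1) ∧
        zeroSet (A 1) ⊆ ((↑) : ℝ → ℂ) '' interior Γ₂ ∧
        SimpleZeros (A 1)) := by
  obtain ⟨J, ν₁, ν₂, c₁, c₂, hd, hc₁, hc₂, hμ₁, hμ₂⟩ := h.exists_data
  have hne : ∀ {r₁ r₂ : ℝ[X]}, n₁ + n₂ ≠ 0 → (∀ k < n₁ + n₂,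
      formMoment ν₁ ν₂ (c₁ • r₁) (c₂ • r₂) k = if k + 1 = n₁ + n₂ then 1 else 0) →
      c₁ • r₁ ≠ 0 ∨ c₂ • r₂ ≠ 0 := fun hn hr => by
    by_contra! hc
    have := hr (n₁ + n₂ - 1) (by omega)
    rw [hc.1, hc.2, if_pos (by omega)] at this
    simp [formMoment] at this
  have horth : ∀ {r₁ r₂ : ℝ[X]}, (∀ k < n₁ + n₂,
      formMoment ν₁ ν₂ (c₁ • r₁) (c₂ • r₂) k = if k + 1 = n₁ + n₂ then 1 else 0) →
      ∀ k < n₁ + n₂ - 1, formMoment ν₁ ν₂ (c₁ • r₁) (c₂ • r₂) k = 0 := fun hr k hk => by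
    rw [hr k (by omega), if_neg (by omega)]
  constructor
  · intro hn hn₁
    obtain ⟨r₁, r₂, hr₁, hr₂, hr, hA⟩ := existsUnique_isTypeI (n₁ := n₁) (n₂ := n₂) hd hc₁ hc₂
      hμ₁ hμ₂ (by omega)
    refine ⟨⟨_, (hA _).2 rfl, fun A => (hA A).1⟩, fun A hA' => ?_⟩
    -- Since n₁ ≥ 1, the |n| - 1 vanishing moments number at least n₂. They leave n₁ - 1 zeros, the
    -- most the degree allows, so all are simple and interior.
    obtain ⟨h0, T, hT, hTc⟩ := hd.exists_zeros_left ((degree_smul_le c₁ r₁).trans_lt hr₁)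
      ((degree_smul_le c₂ r₂).trans_lt hr₂) hn (by omega : n₂ ≤ n₁ + n₂ - 1)
      (hne (by omega) hr) (horth hr)
    have hz := zeros_of_card_add_one_ge (p := r₁) (I := interior Γ₂) (T := T)
      (right_ne_zero_of_smul h0) hr₁ (fun z hz => ⟨(hT z hz).1, by simpa [hc₁] using (hT z hz).2⟩)
      (by omega)
    rw [(hA A).1 hA']
    exact ⟨hz.1.trans (Set.image_subset_range _ _), hz⟩
  · intro hn hn₂
    obtain ⟨r₁, r₂, hr₁, hr₂, hr, hA⟩ := existsUnique_isTypeI (n₁ := n₁) (n₂ := n₂) hd hc₁ hc₂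
      hμ₁ hμ₂ (by omega)
    refine ⟨⟨_, (hA _).2 rfl, fun A => (hA A).1⟩, fun A hA' => ?_⟩
    obtain ⟨h0, T, hT, hTc⟩ := hd.exists_zeros_right ((degree_smul_le c₁ r₁).trans_lt hr₁)
      ((degree_smul_le c₂ r₂).trans_lt hr₂) hn (by omega : n₁ ≤ n₁ + n₂ - 1)
      (hne (by omega) hr) (horth hr)
    have hz := zeros_of_card_add_one_ge (p := r₂) (I := interior Γ₂) (T := T)
      (right_ne_zero_of_smul h0) hr₂ (fun z hz => ⟨(hT z hz).1, by simpa [hc₂] using (hT z hz).2⟩)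
      (by omega)
    rw [(hA A).1 hA']
    exact ⟨hz.1.trans (Set.image_subset_range _ _), hz⟩
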